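/- **Theorem.** Let $d \ge 1$. Let $BV([0,1]^d)$ be the space of (classes of) integrable functions $u : \mathbb{R}^d \to \mathbb{R}$ that vanish almost everywhere outside $[0,1]^d$ and have finite variation $$\|Du\|(\mathbb{R}^d) = \sup\Big\{ \int_{\mathbb{R}^d} u \operatorname{div} v \;:\; v \in C^1_c(\mathbb{R}^d;\mathbb{R}^d),\ |v(x)| \le 1 \text{ for all } x \Big\},$$ normed by $\|u\|_{BV} = \|u\|_1 + \|Du\|(\mathbb{R}^d)$. Every $u \in BV([0,1]^d)$ has a distributional gradient $Du$ that is an $\mathbb{R}^d$-valued Borel measure on $\mathbb{R}^d$, that is, $\int u \operatorname{div} v = -\int v \cdot dDu$ for all $v \in C^1_c(\mathbb{R}^d;\mathbb{R}^d)$. For every $f \in L^d([0,1]^d)$ the functional $T_f(u) = \int_{[0,1]^d} f u$ is well defined and belongs to the normed dual $BV([0,1]^d)^*$. Let $SCH([0,1]^d)$, the space of strong charge functionals, be the closure of $\{T_f : f \in L^d([0,1]^d)\}$ in $BV([0,1]^d)^*$. Then the formula $$(\mathfrak{div}\, v)(u) = -\int_{[0,1]^d} v \cdot dDu, \qquad u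 \in BV([0,1]^d),$$ defines a continuous linear operator $\mathfrak{div} : C([0,1]^d;\mathbb{R}^d) \to SCH([0,1]^d)$, and this operator is onto: for every strong charge functional $\alpha$ there is a continuous vector field $v : [0,1]^d \to \mathbb{R}^d$ with $\alpha(u) = -\int_{[0,1]^d} v \cdot dDu$ for all $u \in BV([0,1]^d)$. -/

import Mathlib

open MeasureTheory
open scoped ENNReal

noncomputable section

namespace StrongCharge

/-- The space `ℝ^d` with its Euclidean norm and Lebesgue measure. -/
abbrev Euc (d : ℕ) : Type := EuclideanSpace ℝ (Fin d)

/-- The closed unit cube `[0,1]^d`. -/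
def cube (d : ℕ) : Set (Euc d) := {x | ∀ i, x i ∈ Set.Icc (0 : ℝ) 1}

/-- The divergence `∑ i, ∂ᵢ vᵢ` of a (differentiable) vector field. -/
def divergence {d : ℕ} (v : Euc d → Euc d) (x : Euc d) : ℝ :=
  ∑ i, (fderiv ℝ v x (EuclideanSpace.single i 1)) i

/-- Compactly supported continuously differentiable vector fields, `C¹_c(ℝ^d; ℝ^d)`. -/
def IsTestField {d : ℕ} (v : Euc d → Euc d) : Prop :=
  ContDiff ℝ 1 v ∧ HasCompactSupport v

/-- The variation `‖Du‖(ℝ^d)`: the supremum of `∫ u div v` over the fields `v ∈ C¹_c(ℝ^d; ℝ^d)`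
with `|v| ≤ 1`. (The field `v = 0` is admissible, so nothing is lost by truncating at `0`.) -/
def variation {d : ℕ} (u : Euc d → ℝ) : ℝ≥0∞ :=
  ⨆ (v : Euc d → Euc d) (_ : IsTestField v) (_ : ∀ x, ‖v x‖ ≤ 1),
    ENNReal.ofReal (∫ x, u x * divergence v x)

lemma IsTestField.continuous_divergence {d : ℕ} {v : Euc d → Euc d} (hv : IsTestField v) :
    Continuous (divergence v) := by
  have h : Continuous (fderiv ℝ v) := hv.1.continuous_fderiv one_ne_zero
  unfold divergence
  fun_prop

lemma IsTestField.hasCompactSupport_divergence {d : ℕ} {v : Euc d → Euc d}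
    (hv : IsTestField v) : HasCompactSupport (divergence v) := by
  have h : HasCompactSupport (fderiv ℝ v) := hv.2.fderiv ℝ
  exact h.comp_left (g := fun L : Euc d →L[ℝ] Euc d =>
    ∑ i, (L (EuclideanSpace.single i 1)) i) (by simp)

lemma IsTestField.integrable_mul {d : ℕ} {v : Euc d → Euc d} (hv : IsTestField v)
    {u : Euc d → ℝ} (hu : Integrable u) : Integrable (fun x => u x * divergence v x) := by
  obtain ⟨C, hC⟩ := hv.hasCompactSupport_divergence.exists_bound_of_continuous
    hv.continuous_divergence
  exact hu.mul_bdd hv.continuous_divergence.aestronglyMeasurable (.of_forall hC)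

lemma variation_congr {d : ℕ} {u w : Euc d → ℝ} (h : u =ᵐ[volume] w) :
    variation u = variation w := by
  unfold variation
  have key : ∀ v : Euc d → Euc d,
      ∫ x, u x * divergence v x = ∫ x, w x * divergence v x := fun v =>
    integral_congr_ae (h.mono fun x hx => congrArg (· * divergence v x) hx)
  simp only [key]

lemma le_variation {d : ℕ} (u : Euc d → ℝ) {v : Euc d → Euc d} (hv : IsTestField v)
    (h1 : ∀ x, ‖v x‖ ≤ 1) :
    ENNReal.ofReal (∫ x, u x * divergence v x) ≤ variation u :=
  le_iSup_of_le v (le_iSup_of_le hv (le_iSup_of_le h1 le_rfl))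

lemma variation_zero {d : ℕ} : variation (fun _ : Euc d => (0 : ℝ)) = 0 := by
  simp [variation]

lemma variation_add_le {d : ℕ} {u w : Euc d → ℝ} (hu : Integrable u) (hw : Integrable w) :
    variation (u + w) ≤ variation u + variation w := by
  refine iSup_le fun v => iSup_le fun hv => iSup_le fun h1 => ?_
  have : ∫ x, (u + w) x * divergence v x
      = (∫ x, u x * divergence v x) + ∫ x, w x * divergence v x := by
    rw [← integral_add (hv.integrable_mul hu) (hv.integrable_mul hw)]
    simp only [Pi.add_apply, add_mul]
  rw [this]
  exact ENNReal.ofReal_add_le.trans (add_le_add (le_variation u hv h1) (le_variation w hv h1))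

lemma divergence_neg {d : ℕ} (v : Euc d → Euc d) (x : Euc d) :
    divergence (-v) x = -divergence v x := by
  simp [divergence, fderiv_neg]

lemma variation_smul_le {d : ℕ} (c : ℝ) (u : Euc d → ℝ) :
    variation (c • u) ≤ ENNReal.ofReal |c| * variation u := by
  refine iSup_le fun v => iSup_le fun hv => iSup_le fun h1 => ?_
  have key : ∫ x, (c • u) x * divergence v x = c * ∫ x, u x * divergence v x := by
    rw [← integral_const_mul]
    simp only [Pi.smul_apply, smul_eq_mul, mul_assoc]
  rw [key]
  rcases le_total 0 c with hc | hc
  · rw [abs_of_nonneg hc, ENNReal.ofReal_mul hc]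
    gcongr
    exact le_variation u hv h1
  · have hneg : c * ∫ x, u x * divergence v x = (-c) * ∫ x, u x * divergence (-v) x := by
      simp only [divergence_neg, mul_neg, integral_neg, neg_mul, neg_neg]
    rw [abs_of_nonpos hc, hneg, ENNReal.ofReal_mul (neg_nonneg.2 hc)]
    gcongr
    refine le_variation u ⟨hv.1.neg, hv.2.neg⟩ (fun x => ?_)
    simpa using h1 x

/-- The vector space `BV([0,1]^d)`: (classes of) integrable functions `u` on `ℝ^d` that vanish
almost everywhere outside `[0,1]^d` and satisfy `‖Du‖(ℝ^d) < ∞`. -/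
def bvSubmodule (d : ℕ) : Submodule ℝ (Lp ℝ 1 (volume : Measure (Euc d))) where
  carrier := {u | (∀ᵐ x, x ∉ cube d → u x = 0) ∧ variation (u : Euc d → ℝ) < ∞}
  zero_mem' := by
    refine ⟨(Lp.coeFn_zero ℝ 1 (volume : Measure (Euc d))).mono fun x hx _ => by simp [hx], ?_⟩
    rw [variation_congr (Lp.coeFn_zero ℝ 1 (volume : Measure (Euc d)))]
    exact (variation_zero (d := d)).trans_lt ENNReal.zero_lt_top
  add_mem' := by
    rintro u w ⟨hu, hu'⟩ ⟨hw, hw'⟩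
    refine ⟨?_, ?_⟩
    · filter_upwards [hu, hw, Lp.coeFn_add u w] with x h1 h2 h3 hx
      refine h3.trans ?_
      simp [h1 hx, h2 hx]
    · rw [variation_congr (Lp.coeFn_add u w)]
      exact (variation_add_le (L1.integrable_coeFn u) (L1.integrable_coeFn w)).trans_lt
        (ENNReal.add_lt_top.2 ⟨hu', hw'⟩)
  smul_mem' := by
    rintro c u ⟨hu, hu'⟩
    refine ⟨?_, ?_⟩
    · filter_upwards [hu, Lp.coeFn_smul c u] with x h1 h3 hx
      simp [h3, h1 hx]
    · rw [variation_congr (Lp.coeFn_smul c u)]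
      exact (variation_smul_le c u).trans_lt (ENNReal.mul_lt_top ENNReal.ofReal_lt_top hu')

/-- The space `BV([0,1]^d)`. It is a separate type because its norm is the `BV` norm below and
not the norm inherited from `L¹`. -/
def BV (d : ℕ) : Type := bvSubmodule d

instance (d : ℕ) : AddCommGroup (BV d) := inferInstanceAs (AddCommGroup (bvSubmodule d))

instance (d : ℕ) : Module ℝ (BV d) := inferInstanceAs (Module ℝ (bvSubmodule d))

/-- The class in `L¹(ℝ^d)` of an element of `BV([0,1]^d)`. -/
def BV.toL1 {d : ℕ} : BV d →ₗ[ℝ] Lp ℝ 1 (volume : Measure (Euc d)) := (bvSubmodule d).subtype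

instance (d : ℕ) : CoeFun (BV d) (fun _ => Euc d → ℝ) := ⟨fun u => BV.toL1 u⟩

lemma BV.variation_lt_top {d : ℕ} (u : BV d) : variation u < ∞ := u.2.2

/-- The norm `‖u‖_BV = ‖u‖₁ + ‖Du‖(ℝ^d)`. -/
def BV.groupNorm (d : ℕ) : AddGroupNorm (BV d) where
  toFun u := ‖BV.toL1 u‖ + (variation u).toReal
  map_zero' := by
    have h : variation (0 : BV d) = 0 := by
      rw [map_zero, variation_congr (Lp.coeFn_zero ℝ 1 (volume : Measure (Euc d)))]
      exact variation_zero
    rw [h]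
    simp
  add_le' u w := by
    have h : variation (u + w : BV d) ≤ variation u + variation w := by
      rw [map_add, variation_congr (Lp.coeFn_add _ _)]
      exact variation_add_le (L1.integrable_coeFn _) (L1.integrable_coeFn _)
    have h' := ENNReal.toReal_mono
      (ENNReal.add_lt_top.2 ⟨u.variation_lt_top, w.variation_lt_top⟩).ne h
    rw [ENNReal.toReal_add u.variation_lt_top.ne w.variation_lt_top.ne] at h'
    have h2 : ‖BV.toL1 (u + w)‖ ≤ ‖BV.toL1 u‖ + ‖BV.toL1 w‖ := by
      rw [map_add]
      exact norm_add_le _ _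
    linarith
  neg' u := by
    have h : ∀ w : BV d, variation (-w : BV d) ≤ variation w := fun w => by
      have := variation_smul_le (-1) (BV.toL1 w)
      rw [map_neg, variation_congr (Lp.coeFn_neg _)]
      simpa using this
    have h' : variation (-u : BV d) = variation u :=
      le_antisymm (h u) (by simpa only [neg_neg] using h (-u))
    rw [h', map_neg, norm_neg]
  eq_zero_of_map_eq_zero' u hu := by
    have h1 : ‖BV.toL1 u‖ = 0 := by
      have h2 := norm_nonneg (BV.toL1 u)
      have h3 : 0 ≤ (variation u).toReal := ENNReal.toReal_nonneg
      linarith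
    exact Subtype.ext (norm_eq_zero.1 h1)

instance (d : ℕ) : NormedAddCommGroup (BV d) := (BV.groupNorm d).toNormedAddCommGroup

lemma BV.norm_def {d : ℕ} (u : BV d) : ‖u‖ = ‖BV.toL1 u‖ + (variation u).toReal := rfl

instance (d : ℕ) : NormedSpace ℝ (BV d) where
  norm_smul_le c u := by
    rw [BV.norm_def, BV.norm_def, map_smul, norm_smul, mul_add,
      variation_congr (Lp.coeFn_smul c _)]
    have h := ENNReal.toReal_mono
      (ENNReal.mul_lt_top ENNReal.ofReal_lt_top u.variation_lt_top).ne
      (variation_smul_le c (BV.toL1 u))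
    rw [ENNReal.toReal_mul, ENNReal.toReal_ofReal (abs_nonneg c)] at h
    simpa using h

/-- The Euclidean inner product of `ℝ^d` as a continuous bilinear map. -/
def dotCLM (d : ℕ) : Euc d →L[ℝ] Euc d →L[ℝ] ℝ := innerSL ℝ

/-- The `ℝ^d`-valued Borel measure `μ` is the distributional gradient of `u`:
`∫ u div v = - ∫ v · dμ` for all `v ∈ C¹_c(ℝ^d; ℝ^d)`. -/
def IsGradient {d : ℕ} (u : Euc d → ℝ) (μ : VectorMeasure (Euc d) (Euc d)) : Prop :=
  ∀ v : Euc d → Euc d, IsTestField v →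
    ∫ x, u x * divergence v x = -(μ.integral v (dotCLM d))

open Classical in
/-- The distributional gradient `Du` of `u ∈ BV([0,1]^d)`, an `ℝ^d`-valued Borel measure on
`ℝ^d` (such a measure exists and is unique). -/
def BV.grad {d : ℕ} (u : BV d) : VectorMeasure (Euc d) (Euc d) :=
  if h : ∃ μ, IsGradient u μ then h.choose else 0

/-- The functional `u ↦ - ∫_{[0,1]^d} v · dDu` on `BV([0,1]^d)` attached to a continuous vector
field `v` on `[0,1]^d`. Values of the integrand outside `[0,1]^d` are irrelevant. -/
def fracDiv {d : ℕ} (v : C(cube d, Euc d)) (u : BV d) : ℝ :=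
  -((u.grad.restrict (cube d)).integral (Function.extend Subtype.val v 0) (dotCLM d))

/-- `α = T_f`, that is, `α(u) = ∫_{[0,1]^d} f u` for all `u ∈ BV([0,1]^d)`. -/
def Represents {d : ℕ} (f : Euc d → ℝ) (α : StrongDual ℝ (BV d)) : Prop :=
  ∀ u : BV d, IntegrableOn (fun x => f x * u x) (cube d) ∧ α u = ∫ x in cube d, f x * u x

/-- The range of `T : L^d([0,1]^d) → BV([0,1]^d)^*`, `f ↦ T_f`. -/
def rangeT (d : ℕ) : Submodule ℝ (StrongDual ℝ (BV d)) where
  carrier := {α | ∃ f : Euc d → ℝ, MemLp f d (volume.restrict (cube d)) ∧ Represents f α}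
  zero_mem' := ⟨0, MemLp.zero, fun u => by simp⟩
  add_mem' := by
    rintro α β ⟨f, hf, hα⟩ ⟨g, hg, hβ⟩
    refine ⟨f + g, hf.add hg, fun u => ?_⟩
    have h : (fun x => (f + g) x * u x) = fun x => f x * u x + g x * u x := by
      funext x
      simp [add_mul]
    rw [h]
    refine ⟨(hα u).1.add (hβ u).1, ?_⟩
    rw [integral_add (hα u).1 (hβ u).1, ← (hα u).2, ← (hβ u).2]
    rfl
  smul_mem' := by
    rintro c α ⟨f, hf, hα⟩
    refine ⟨c • f, hf.const_smul c, fun u => ?_⟩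
    have h : (fun x => (c • f) x * u x) = fun x => c * (f x * u x) := by
      funext x
      simp [mul_assoc]
    rw [h]
    refine ⟨(hα u).1.const_mul c, ?_⟩
    rw [integral_const_mul, ← (hα u).2]
    rfl

/-- The space `SCH([0,1]^d)` of strong charge functionals: the closure of the range of `T` in
the normed dual `BV([0,1]^d)^*`. -/
def SCH (d : ℕ) : Submodule ℝ (StrongDual ℝ (BV d)) := (rangeT d).topologicalClosure

end StrongCharge

end

open StrongCharge

/-!
Mollification and the Gagliardo–Nirenberg–Sobolev inequality embed `BV([0,1]^d)` in `L^p`, where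
`1/d + 1/p = 1`, so every `f ∈ L^d` defines a functional `T_f`; they also give the Poincaré
inequality `‖u‖_{BV} ≤ C ‖Du‖`. The gradients of the mollifications of `u` are bounded in `L^1` and
supported in a fixed compact set, and a weak limit point of them is `Du`. Every continuous field on
the cube is a uniform limit of test fields `w`, for which `𝔡𝔦𝔳 w = T_{div w}`, so `𝔡𝔦𝔳` takes its
values in `SCH`.

For surjectivity, let `ξ` be a functional on `SCH`. By Radon–Nikodym, `f ↦ ξ(T_f)` is represented on
bounded `f` by a density `u ∈ L^1`. Testing with `f = div w` bounds the variation of `u` by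
`‖ξ ∘ 𝔡𝔦𝔳‖`, so `u ∈ BV` and, by density of the range of `T`, `ξ` is evaluation at `u`. The Poincaré
inequality then reads `‖ξ‖ ≤ C ‖ξ ∘ 𝔡𝔦𝔳‖`: the adjoint of `𝔡𝔦𝔳` is bounded below, which by
Hahn–Banach and successive approximation makes `𝔡𝔦𝔳` onto.
-/

noncomputable section

namespace StrongCharge

open Filter Topology Set ContinuousLinearMap
open scoped Convolution ContDiff Gradient InnerProductSpace Manifold NNReal Pointwise

/-- A sequence of bump functions whose supports shrink to the origin. -/
def shrinkingBump (E : Type*) [NormedAddCommGroup E] (n : ℕ) : ContDiffBump (0 : E) where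
  rIn := 1 / (n + 1)
  rOut := 2 / (n + 1)
  rIn_pos := by positivity
  rIn_lt_rOut := by gcongr; norm_num

/-- The mollification of `u` by the normalized bump function `φ`. -/
def mollify {E : Type*} [NormedAddCommGroup E] [NormedSpace ℝ E] [HasContDiffBump E]
    [MeasurableSpace E] (μ : Measure E) (φ : ContDiffBump (0 : E)) (u : E → ℝ) : E → ℝ :=
  φ.normed μ ⋆[lsmul ℝ ℝ, μ] u

lemma tendsto_rOut_shrinkingBump (E : Type*) [NormedAddCommGroup E] :
    Tendsto (fun n => (shrinkingBump E n).rOut) atTop (𝓝 0) := by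
  simpa [shrinkingBump, div_eq_mul_inv] using
    (tendsto_one_div_add_atTop_nhds_zero_nat (𝕜 := ℝ)).const_mul 2

section Mollification

variable {E : Type*} [NormedAddCommGroup E] [MeasurableSpace E] [BorelSpace E] {μ : Measure E}

lemma continuous_integral_mul_translate [SecondCountableTopology E] {u g : E → ℝ}
    (hu : Integrable u μ) (hg : Continuous g) {C : ℝ} (hC : ∀ x, ‖g x‖ ≤ C) :
    Continuous fun y => ∫ x, u x * g (x + y) ∂μ := by
  refine continuous_of_dominated (bound := fun x => ‖u x‖ * C) (fun y => ?_)
    (fun y => .of_forall fun x => ?_) (hu.norm.mul_const C) (.of_forall fun x => by fun_prop)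
  · exact hu.1.mul (by fun_prop : Continuous fun x => g (x + y)).aestronglyMeasurable
  · rw [norm_mul]
    gcongr
    exact hC _

variable [NormedSpace ℝ E] [FiniteDimensional ℝ E] [HasContDiffBump E] [μ.IsAddHaarMeasure]

lemma contDiff_mollify (φ : ContDiffBump (0 : E)) {u : E → ℝ} (hu : Integrable u μ) :
    ContDiff ℝ ∞ (mollify μ φ u) :=
  φ.hasCompactSupport_normed.contDiff_convolution_left _ φ.contDiff_normed hu.locallyIntegrable

lemma integrable_mollify (φ : ContDiffBump (0 : E)) {u : E → ℝ} (hu : Integrable u μ) :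
    Integrable (mollify μ φ u) μ :=
  φ.integrable_normed.integrable_convolution _ hu

lemma tsupport_mollify_subset (φ : ContDiffBump (0 : E)) {u : E → ℝ} (hu : HasCompactSupport u) :
    tsupport (mollify μ φ u) ⊆ tsupport u + Metric.closedBall 0 φ.rOut := by
  refine closure_minimal ?_ (hu.isCompact.add (isCompact_closedBall _ _)).isClosed
  refine (support_convolution_subset_swap _).trans (add_subset_add (subset_tsupport u) ?_)
  rw [φ.support_normed_eq]
  exact Metric.ball_subset_closedBall

lemma hasCompactSupport_mollify (φ : ContDiffBump (0 : E)) {u : E → ℝ}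
    (hu : HasCompactSupport u) : HasCompactSupport (mollify μ φ u) :=
  φ.hasCompactSupport_normed.convolution _ hu

lemma integral_mollify_mul (φ : ContDiffBump (0 : E)) {u g : E → ℝ} (hu : Integrable u μ)
    (hg : Continuous g) {C : ℝ} (hC : ∀ x, ‖g x‖ ≤ C) :
    ∫ x, mollify μ φ u x * g x ∂μ = ∫ y, φ.normed μ y * ∫ x, u x * g (x + y) ∂μ ∂μ := by
  have hint : Integrable (fun p : E × E => φ.normed μ p.2 * u (p.1 - p.2) * g p.1) (μ.prod μ) :=
    (φ.integrable_normed.convolution_integrand (lsmul ℝ ℝ) hu).mul_bdd (c := C)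
      (hg.comp continuous_fst).aestronglyMeasurable (.of_forall fun p => hC p.1)
  calc ∫ x, mollify μ φ u x * g x ∂μ
      = ∫ x, ∫ y, φ.normed μ y * u (x - y) * g x ∂μ ∂μ := by
        simp only [mollify, convolution_def, lsmul_apply, smul_eq_mul, ← integral_mul_const]
    _ = ∫ y, ∫ x, φ.normed μ y * u (x - y) * g x ∂μ ∂μ := integral_integral_swap hint
    _ = ∫ y, φ.normed μ y * ∫ x, u x * g (x + y) ∂μ ∂μ := by
        congr 1 with y
        rw [← integral_sub_right_eq_self (fun x => u x * g (x + y)) y, ← integral_const_mul]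
        simp only [sub_add_cancel, mul_assoc]

lemma tendsto_integral_mollify_mul {ι : Type*} {l : Filter ι} {φ : ι → ContDiffBump (0 : E)}
    (hφ : Tendsto (fun i => (φ i).rOut) l (𝓝 0)) {u g : E → ℝ} (hu : Integrable u μ)
    (hg : Continuous g) {C : ℝ} (hC : ∀ x, ‖g x‖ ≤ C) :
    Tendsto (fun i => ∫ x, mollify μ (φ i) u x * g x ∂μ) l (𝓝 (∫ x, u x * g x ∂μ)) := by
  have h := ContDiffBump.convolution_tendsto_right_of_continuous (μ := μ) hφ
    ((continuous_integral_mul_translate hu hg hC).comp continuous_neg) (0 : E)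
  simpa [integral_mollify_mul _ hu hg hC, convolution_def] using h

lemma tsupport_mollify_shrinkingBump_subset {u : E → ℝ} (hu : HasCompactSupport u) (n : ℕ) :
    tsupport (mollify μ (shrinkingBump E n) u) ⊆ tsupport u + Metric.closedBall 0 2 :=
  (tsupport_mollify_subset _ hu).trans <| add_subset_add_left <|
    Metric.closedBall_subset_closedBall (div_le_self zero_le_two (by simp))

lemma ae_tendsto_mollify_shrinkingBump {u : E → ℝ} (hu : Integrable u μ) :
    ∀ᵐ x ∂μ, Tendsto (fun n => mollify μ (shrinkingBump E n) u x) atTop (𝓝 (u x)) :=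
  ContDiffBump.ae_convolution_tendsto_right_of_locallyIntegrable (K := 2)
    (tendsto_rOut_shrinkingBump E)
    (.of_forall fun n => by simp [shrinkingBump, div_eq_mul_inv]) hu.locallyIntegrable

end Mollification

section TestFields

variable {d : ℕ}

lemma IsTestField.translate {v : Euc d → Euc d} (hv : IsTestField v) (y : Euc d) :
    IsTestField (fun x => v (x + y)) :=
  ⟨hv.1.comp (contDiff_id.add contDiff_const), hv.2.comp_homeomorph (Homeomorph.addRight y)⟩

lemma IsTestField.smul {φ : Euc d → ℝ} (hφ : ContDiff ℝ 1 φ) (hc : HasCompactSupport φ)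
    {v : Euc d → Euc d} (hv : ContDiff ℝ 1 v) : IsTestField (fun x => φ x • v x) :=
  ⟨hφ.smul hv, hc.smul_right⟩

lemma divergence_translate (v : Euc d → Euc d) (x y : Euc d) :
    divergence (fun x => v (x + y)) x = divergence v (x + y) := by
  simp only [divergence, fderiv_comp_add_right]

lemma IsTestField.exists_bound_divergence {v : Euc d → Euc d} (hv : IsTestField v) :
    ∃ C, ∀ x, ‖divergence v x‖ ≤ C :=
  hv.hasCompactSupport_divergence.exists_bound_of_continuous hv.continuous_divergence

lemma integral_mul_divergence_le {u : Euc d → ℝ} (hu : variation u ≠ ⊤) {v : Euc d → Euc d}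
    (hv : IsTestField v) (h1 : ∀ x, ‖v x‖ ≤ 1) :
    ∫ x, u x * divergence v x ≤ (variation u).toReal :=
  (ENNReal.ofReal_le_iff_le_toReal hu).1 (le_variation u hv h1)

lemma divergence_const_smul (c : ℝ) (v : Euc d → Euc d) (x : Euc d) :
    divergence (c • v) x = c * divergence v x := by
  simp only [divergence, fderiv_const_smul_field, Pi.smul_apply, _root_.smul_apply,
    PiLp.smul_apply, smul_eq_mul, Finset.mul_sum]

lemma abs_integral_mul_divergence_le {u : Euc d → ℝ} (hu : variation u ≠ ⊤) {v : Euc d → Euc d}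
    (hv : IsTestField v) {M : ℝ} (hM : 0 < M) (hvM : ∀ x, ‖v x‖ ≤ M) :
    |∫ x, u x * divergence v x| ≤ M * (variation u).toReal := by
  have hscaled (c : ℝ) (hc : |c| = M⁻¹) :
      c * ∫ x, u x * divergence v x ≤ (variation u).toReal := by
    have h := integral_mul_divergence_le hu (v := c • v)
      ⟨hv.1.const_smul c, hv.2.smul_left⟩ fun x => by
        rw [Pi.smul_apply, norm_smul, Real.norm_eq_abs, hc]
        exact (inv_mul_le_one₀ hM).2 (hvM x)
    simpa only [divergence_const_smul, mul_left_comm _ c, integral_const_mul] using h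
  have hupper := hscaled M⁻¹ (abs_of_pos (inv_pos.2 hM))
  have hlower := hscaled (-M⁻¹) (by rw [abs_neg, abs_of_pos (inv_pos.2 hM)])
  rw [inv_mul_le_iff₀ hM] at hupper
  rw [neg_mul, ← mul_neg, inv_mul_le_iff₀ hM] at hlower
  exact abs_le'.2 ⟨hupper, hlower⟩

lemma variation_mollify_le (φ : ContDiffBump (0 : Euc d)) {u : Euc d → ℝ} (hu : Integrable u) :
    variation (mollify volume φ u) ≤ variation u := by
  by_cases hV : variation u = ⊤
  · exact hV ▸ le_top
  refine iSup_le fun v => iSup_le fun hv => iSup_le fun h1 => ?_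
  rw [ENNReal.ofReal_le_iff_le_toReal hV]
  obtain ⟨C, hC⟩ := hv.exists_bound_divergence
  have hint : Integrable fun y => φ.normed volume y * ∫ x, u x * divergence v (x + y) :=
    (φ.continuous_normed.mul (continuous_integral_mul_translate hu
      hv.continuous_divergence hC)).integrable_of_hasCompactSupport
        φ.hasCompactSupport_normed.mul_right
  calc ∫ x, mollify volume φ u x * divergence v x
      = ∫ y, φ.normed volume y * ∫ x, u x * divergence v (x + y) :=
        integral_mollify_mul φ hu hv.continuous_divergence hC
    _ ≤ ∫ y, φ.normed volume y * (variation u).toReal := by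
        refine integral_mono hint (φ.integrable_normed.mul_const _) fun y => ?_
        refine mul_le_mul_of_nonneg_left ?_ (φ.nonneg_normed y)
        simpa only [divergence_translate] using
          integral_mul_divergence_le hV (hv.translate y) fun x => h1 (x + y)
    _ = (variation u).toReal := by rw [integral_mul_const, φ.integral_normed, one_mul]

lemma divergence_eq_sum {v : Euc d → Euc d} (hv : Differentiable ℝ v) (x : Euc d) :
    divergence v x = ∑ i, fderiv ℝ (fun y => v y i) x (EuclideanSpace.single i 1) := by
  refine Finset.sum_congr rfl fun i _ => ?_
  have h : HasFDerivAt (fun y => v y i) ((EuclideanSpace.proj i).comp (fderiv ℝ v x)) x :=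
    (EuclideanSpace.proj (𝕜 := ℝ) i).hasFDerivAt.comp x (hv x).hasFDerivAt
  rw [h.fderiv]
  rfl

lemma clm_apply_eq_sum_single (L : Euc d →L[ℝ] ℝ) (y : Euc d) :
    L y = ∑ i, L (EuclideanSpace.single i 1) * y i := by
  conv_lhs => rw [← (EuclideanSpace.basisFun (Fin d) ℝ).sum_repr y, map_sum]
  simp [mul_comm]

lemma integral_mul_divergence {w : Euc d → ℝ} {v : Euc d → Euc d} (hw : ContDiff ℝ 1 w)
    (hv : IsTestField v) : ∫ x, w x * divergence v x = -∫ x, fderiv ℝ w x (v x) := by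
  have hvi (i) : ContDiff ℝ 1 fun x => v x i :=
    (EuclideanSpace.proj (𝕜 := ℝ) i).contDiff.comp hv.1
  have hcvi (i) : HasCompactSupport fun x => v x i :=
    hv.2.comp_left (g := fun y : Euc d => y i) rfl
  have hint0 (i) : Integrable fun x => w x * v x i :=
    (hw.continuous.mul (hvi i).continuous).integrable_of_hasCompactSupport (hcvi i).mul_left
  have hint1 (i) :
      Integrable fun x => w x * fderiv ℝ (fun y => v y i) x (EuclideanSpace.single i 1) :=
    (hw.continuous.mul (((hvi i).continuous_fderiv one_ne_zero).clm_apply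
      continuous_const)).integrable_of_hasCompactSupport ((hcvi i).fderiv_apply ℝ _).mul_left
  have hint2 (i) : Integrable fun x => fderiv ℝ w x (EuclideanSpace.single i 1) * v x i :=
    (((hw.continuous_fderiv one_ne_zero).clm_apply continuous_const).mul
      (hvi i).continuous).integrable_of_hasCompactSupport (hcvi i).mul_left
  simp only [divergence_eq_sum (hv.1.differentiable one_ne_zero),
    fun x => clm_apply_eq_sum_single (fderiv ℝ w x) (v x), Finset.mul_sum]
  rw [integral_finsetSum _ fun i _ => hint1 i, integral_finsetSum _ fun i _ => hint2 i,
    ← Finset.sum_neg_distrib]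
  exact Finset.sum_congr rfl fun i _ =>
    integral_mul_fderiv_eq_neg_fderiv_mul_of_integrable (hint2 i) (hint1 i) (hint0 i)
      (fun x _ => hw.differentiable one_ne_zero x) (fun x _ => (hvi i).differentiable one_ne_zero x)

end TestFields

section Sobolev

variable {d : ℕ}

lemma sq_div_sqrt_le_self {a : ℝ} (ha : 0 ≤ a) (δ : ℝ) : a ^ 2 / √(a ^ 2 + δ ^ 2) ≤ a := by
  refine div_le_of_le_mul₀ (Real.sqrt_nonneg _) ha ?_
  rw [sq]
  exact mul_le_mul_of_nonneg_left (Real.le_sqrt_of_sq_le (by nlinarith)) ha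

lemma tendsto_sq_div_sqrt {a : ℝ} (ha : 0 ≤ a) :
    Tendsto (fun δ : ℝ => a ^ 2 / √(a ^ 2 + δ ^ 2)) (𝓝[>] 0) (𝓝 a) := by
  rcases ha.eq_or_lt with rfl | ha'
  · simp
  have h : ContinuousAt (fun δ : ℝ => a ^ 2 / √(a ^ 2 + δ ^ 2)) 0 :=
    ContinuousAt.div (by fun_prop) (by fun_prop) (by positivity)
  have hval : a ^ 2 / √(a ^ 2 + 0 ^ 2) = a := by
    rw [zero_pow two_ne_zero, add_zero, Real.sqrt_sq ha, sq, mul_self_div_self]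
  exact (hval ▸ h.tendsto).mono_left nhdsWithin_le_nhds

lemma contDiff_gradient {E : Type*} [NormedAddCommGroup E] [InnerProductSpace ℝ E]
    [CompleteSpace E] {w : E → ℝ} (hw : ContDiff ℝ 2 w) : ContDiff ℝ 1 (∇ w) :=
  (InnerProductSpace.toDual ℝ E).symm.contDiff.comp (hw.fderiv_right (by norm_num))

-- Testing against `-∇w / √(|∇w|² + δ²)` and letting `δ → 0` recovers `∫ |∇w|`.
lemma isTestField_normalizedGradient {w : Euc d → ℝ} (hw : ContDiff ℝ 2 w)
    (hwc : HasCompactSupport w) {δ : ℝ} (hδ : 0 < δ) :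
    IsTestField fun x => (-(√(‖∇ w x‖ ^ 2 + δ ^ 2))⁻¹) • ∇ w x := by
  have hg : ContDiff ℝ 1 (∇ w) := contDiff_gradient hw
  have hgc : HasCompactSupport (∇ w) :=
    (hwc.fderiv ℝ).comp_left (map_zero (InnerProductSpace.toDual ℝ (Euc d)).symm)
  have hpos (x) : 0 < ‖∇ w x‖ ^ 2 + δ ^ 2 := by positivity
  have hsqrt : ContDiff ℝ 1 fun x => √(‖∇ w x‖ ^ 2 + δ ^ 2) :=
    ((hg.norm_sq ℝ).add contDiff_const).sqrt fun x => (hpos x).ne'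
  have hscale : ContDiff ℝ 1 fun x => -(√(‖∇ w x‖ ^ 2 + δ ^ 2))⁻¹ :=
    (hsqrt.inv fun x => (Real.sqrt_pos.2 (hpos x)).ne').neg
  exact ⟨hscale.smul hg, hgc.smul_left (f := fun x => -(√(‖∇ w x‖ ^ 2 + δ ^ 2))⁻¹)⟩

lemma integral_norm_fderiv_le_variation {w : Euc d → ℝ} (hw : ContDiff ℝ 2 w)
    (hwc : HasCompactSupport w) (hV : variation w ≠ ⊤) :
    ∫ x, ‖fderiv ℝ w x‖ ≤ (variation w).toReal := by
  have hnorm (x) : ‖∇ w x‖ = ‖fderiv ℝ w x‖ := LinearIsometryEquiv.norm_map _ _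
  have hcont : Continuous (fderiv ℝ w) := hw.continuous_fderiv two_ne_zero
  have hle (δ : ℝ) (hδ : 0 < δ) :
      ∫ x, ‖fderiv ℝ w x‖ ^ 2 / √(‖fderiv ℝ w x‖ ^ 2 + δ ^ 2) ≤ (variation w).toReal := by
    have htest := isTestField_normalizedGradient hw hwc hδ
    have h := integral_mul_divergence_le hV htest fun x => by
      rw [norm_smul, norm_neg, norm_inv, Real.norm_of_nonneg (Real.sqrt_nonneg _)]
      refine inv_mul_le_one_of_le₀ (Real.le_sqrt_of_sq_le (by nlinarith)) (Real.sqrt_nonneg _)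
    have happly (x) : fderiv ℝ w x (∇ w x) = ‖fderiv ℝ w x‖ ^ 2 := by
      rw [← hnorm, ← real_inner_self_eq_norm_sq, gradient, InnerProductSpace.toDual_symm_apply]
    rw [integral_mul_divergence (hw.of_le one_le_two) htest] at h
    simpa only [map_smul, happly, hnorm, smul_eq_mul, neg_mul, integral_neg, neg_neg,
      ← div_eq_inv_mul] using h
  have hlim : Tendsto (fun δ : ℝ => ∫ x, ‖fderiv ℝ w x‖ ^ 2 / √(‖fderiv ℝ w x‖ ^ 2 + δ ^ 2))
      (𝓝[>] 0) (𝓝 (∫ x, ‖fderiv ℝ w x‖)) := by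
    refine tendsto_integral_filter_of_dominated_convergence _
      (.of_forall fun δ => ?_) (.of_forall fun δ => .of_forall fun x => ?_)
      (hcont.integrable_of_hasCompactSupport (hwc.fderiv ℝ)).norm
      (.of_forall fun x => tendsto_sq_div_sqrt (norm_nonneg _))
    · exact (by fun_prop : Measurable fun x =>
        ‖fderiv ℝ w x‖ ^ 2 / √(‖fderiv ℝ w x‖ ^ 2 + δ ^ 2)).aestronglyMeasurable
    · rw [Real.norm_of_nonneg (by positivity)]
      exact sq_div_sqrt_le_self (norm_nonneg _) δ
  exact le_of_tendsto hlim (eventually_mem_nhdsWithin.mono hle)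

lemma eLpNorm_fderiv_one_le_variation {w : Euc d → ℝ} (hw : ContDiff ℝ 2 w)
    (hwc : HasCompactSupport w) : eLpNorm (fderiv ℝ w) 1 volume ≤ variation w := by
  by_cases hV : variation w = ⊤
  · exact hV ▸ le_top
  have hint : Integrable (fderiv ℝ w) :=
    (hw.continuous_fderiv two_ne_zero).integrable_of_hasCompactSupport (hwc.fderiv ℝ)
  rw [eLpNorm_one_eq_lintegral_enorm, ← ofReal_integral_norm_eq_lintegral_enorm hint]
  exact ENNReal.ofReal_le_of_le_toReal (integral_norm_fderiv_le_variation hw hwc hV)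

lemma eLpNorm_top_le_eLpNorm_fderiv_one {w : Euc 1 → ℝ} (hw : ContDiff ℝ 1 w)
    (hwc : HasCompactSupport w) : eLpNorm w ⊤ volume ≤ eLpNorm (fderiv ℝ w) 1 volume := by
  rw [eLpNorm_exponent_top, eLpNorm_one_eq_lintegral_enorm]
  refine eLpNormEssSup_le_of_ae_enorm_bound (.of_forall fun x => ?_)
  let e : ℝ ≃ₗᵢ[ℝ] Euc 1 := (OrthonormalBasis.singleton (Fin 1) ℝ).repr
  have hderiv (t : ℝ) : ‖deriv (w ∘ e) t‖ₑ ≤ ‖fderiv ℝ w (e t)‖ₑ := by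
    have h : HasDerivAt (w ∘ e) (fderiv ℝ w (e t) (e 1)) t :=
      ((hw.differentiable one_ne_zero (e t)).hasFDerivAt.comp t
        e.toContinuousLinearEquiv.hasFDerivAt).hasDerivAt
    rw [h.deriv, enorm_le_iff_norm_le]
    exact (le_opNorm _ _).trans_eq (by simp)
  calc ‖w x‖ₑ = ‖(w ∘ e) (e.symm x)‖ₑ := by simp
    _ ≤ ∫⁻ t in Iic (e.symm x), ‖deriv (w ∘ e) t‖ₑ := by
        exact HasCompactSupport.enorm_le_lintegral_Ici_deriv (hw.comp e.contDiff)
          (hwc.comp_homeomorph e.toHomeomorph) _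
    _ ≤ ∫⁻ t, ‖fderiv ℝ w (e t)‖ₑ :=
        (setLIntegral_le_lintegral _ _).trans (lintegral_mono hderiv)
    _ = ∫⁻ y, ‖fderiv ℝ w y‖ₑ :=
        e.measurePreserving.lintegral_comp_emb e.toHomeomorph.measurableEmbedding
          fun y => ‖fderiv ℝ w y‖ₑ

lemma exists_eLpNorm_le_eLpNorm_fderiv_one (hd : 1 ≤ d) :
    ∃ C : ℝ≥0, ∀ w : Euc d → ℝ, ContDiff ℝ 1 w → HasCompactSupport w →
      eLpNorm w (ENNReal.conjExponent d) volume ≤ C * eLpNorm (fderiv ℝ w) 1 volume := by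
  rcases hd.eq_or_lt with rfl | hd
  -- The conjugate exponent of `1` is `∞`, which Mathlib's Sobolev inequality does not cover.
  · exact ⟨1, fun w hw hwc => by simpa [ENNReal.conjExponent] using
      eLpNorm_top_le_eLpNorm_fderiv_one hw hwc⟩
  · have h1 : (1 : ℝ≥0) < d := by exact_mod_cast hd
    have hexp := ENNReal.coe_conjExponent h1
    rw [ENNReal.coe_natCast] at hexp
    refine ⟨eLpNormLESNormFDerivOneConst (volume : Measure (Euc d))
      (NNReal.conjExponent d), fun w hw hwc => ?_⟩
    rw [← hexp]
    exact eLpNorm_le_eLpNorm_fderiv_one volume hw hwc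
      (by simpa using NNReal.HolderConjugate.conjExponent h1)

theorem exists_eLpNorm_le_variation (hd : 1 ≤ d) :
    ∃ C : ℝ≥0, ∀ u : Euc d → ℝ, Integrable u → HasCompactSupport u →
      eLpNorm u (ENNReal.conjExponent d) volume ≤ C * variation u := by
  obtain ⟨C, hC⟩ := exists_eLpNorm_le_eLpNorm_fderiv_one hd
  refine ⟨C, fun u hu huc => ?_⟩
  set w : ℕ → Euc d → ℝ := fun n => mollify volume (shrinkingBump (Euc d) n) u
  have hw (n) : ContDiff ℝ 2 (w n) := (contDiff_mollify _ hu).of_le (by norm_cast)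
  have hwc (n) : HasCompactSupport (w n) := hasCompactSupport_mollify _ huc
  have hbound (n) : eLpNorm (w n) (ENNReal.conjExponent d) volume ≤ C * variation u :=
    calc _ ≤ C * eLpNorm (fderiv ℝ (w n)) 1 volume := hC _ ((hw n).of_le one_le_two) (hwc n)
      _ ≤ C * variation (w n) := by gcongr; exact eLpNorm_fderiv_one_le_variation (hw n) (hwc n)
      _ ≤ C * variation u := by gcongr; exact variation_mollify_le _ hu
  exact (Lp.eLpNorm_lim_le_liminf_eLpNorm (fun n => (integrable_mollify _ hu).1) u
    (ae_tendsto_mollify_shrinkingBump hu)).trans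
    (liminf_le_of_frequently_le (Frequently.of_forall hbound))

end Sobolev

section BoundedVariation

variable {d : ℕ}

lemma cube_eq_preimage_Icc (d : ℕ) : cube d = WithLp.ofLp ⁻¹' Icc (0 : Fin d → ℝ) 1 := by
  ext x
  simp only [cube, mem_Icc, mem_ofPred_eq, mem_preimage, Pi.le_def, Pi.zero_apply, Pi.one_apply,
    forall_and]

lemma isCompact_cube (d : ℕ) : IsCompact (cube d) := by
  rw [cube_eq_preimage_Icc]
  exact (EuclideanSpace.equiv (Fin d) ℝ).toHomeomorph.isCompact_preimage.2 isCompact_Icc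

lemma measurableSet_cube (d : ℕ) : MeasurableSet (cube d) := (isCompact_cube d).measurableSet

lemma volume_cube (d : ℕ) : volume (cube d) = 1 := by
  rw [cube_eq_preimage_Icc,
    (PiLp.volume_preserving_ofLp (Fin d)).measure_preimage measurableSet_Icc.nullMeasurableSet]
  simp [Real.volume_Icc_pi]

instance : IsProbabilityMeasure (volume.restrict (cube d)) :=
  ⟨by rw [Measure.restrict_apply_univ, volume_cube]⟩

lemma BV.integrable (u : BV d) : Integrable (u : Euc d → ℝ) := L1.integrable_coeFn _

lemma BV.indicator_ae_eq (u : BV d) : (cube d).indicator u =ᵐ[volume] u := by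
  filter_upwards [u.2.1] with x hx
  by_cases h : x ∈ cube d
  · exact indicator_of_mem h _
  · exact (indicator_of_notMem h _).trans (hx h).symm

lemma BV.coeFn_add (u w : BV d) : (u + w : BV d) =ᵐ[volume] (u : Euc d → ℝ) + w := by
  rw [map_add]
  exact Lp.coeFn_add _ _

lemma BV.coeFn_smul (c : ℝ) (u : BV d) : (c • u : BV d) =ᵐ[volume] c • (u : Euc d → ℝ) := by
  rw [map_smul]
  exact Lp.coeFn_smul _ _

lemma BV.toReal_variation_le_norm (u : BV d) : (variation u).toReal ≤ ‖u‖ :=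
  le_add_of_nonneg_left (norm_nonneg _)

lemma hasCompactSupport_indicator_cube (u : Euc d → ℝ) :
    HasCompactSupport ((cube d).indicator u) :=
  HasCompactSupport.intro (isCompact_cube d) fun _ hx => indicator_of_notMem hx _

/-- The class in `BV([0,1]^d)` of an integrable function of finite variation which vanishes
outside the cube. -/
def BV.mk (u : Euc d → ℝ) (hu : Integrable u) (h0 : ∀ x ∉ cube d, u x = 0)
    (hV : variation u < ⊤) : BV d :=
  ⟨hu.toL1 u, hu.coeFn_toL1.mono fun x hx h => hx.trans (h0 x h),
    (variation_congr hu.coeFn_toL1).trans_lt hV⟩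

lemma BV.coeFn_mk {u : Euc d → ℝ} (hu : Integrable u) (h0 : ∀ x ∉ cube d, u x = 0)
    (hV : variation u < ⊤) : (BV.mk u hu h0 hV : Euc d → ℝ) =ᵐ[volume] u :=
  hu.coeFn_toL1

lemma BV.exists_eLpNorm_le_variation (hd : 1 ≤ d) :
    ∃ C : ℝ≥0, ∀ u : BV d, eLpNorm u (ENNReal.conjExponent d) (volume.restrict (cube d))
      ≤ C * variation u := by
  obtain ⟨C, hC⟩ := StrongCharge.exists_eLpNorm_le_variation hd
  refine ⟨C, fun u => ?_⟩
  rw [← eLpNorm_indicator_eq_eLpNorm_restrict (measurableSet_cube d),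
    ← variation_congr u.indicator_ae_eq]
  exact hC _ (u.integrable.indicator (measurableSet_cube d)) (hasCompactSupport_indicator_cube _)

theorem BV.exists_norm_le_variation (hd : 1 ≤ d) :
    ∃ C : ℝ≥0, ∀ u : BV d, ‖u‖ ≤ C * (variation u).toReal := by
  obtain ⟨C, hC⟩ := BV.exists_eLpNorm_le_variation hd
  refine ⟨C + 1, fun u => ?_⟩
  have hL1 : eLpNorm u 1 volume ≤ C * variation u :=
    calc eLpNorm u 1 volume = eLpNorm u 1 (volume.restrict (cube d)) := by
          rw [← eLpNorm_indicator_eq_eLpNorm_restrict (measurableSet_cube d),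
            eLpNorm_congr_ae u.indicator_ae_eq]
      _ ≤ eLpNorm u (ENNReal.conjExponent d) (volume.restrict (cube d)) :=
          eLpNorm_le_eLpNorm_of_exponent_le le_self_add u.integrable.1.restrict
      _ ≤ C * variation u := hC u
  have hnorm : ‖BV.toL1 u‖ ≤ C * (variation u).toReal := by
    simpa [Lp.norm_def] using ENNReal.toReal_mono
      (ENNReal.mul_ne_top ENNReal.coe_ne_top u.variation_lt_top.ne) hL1
  rw [BV.norm_def, NNReal.coe_add, NNReal.coe_one, add_one_mul]
  gcongr

instance {p : ℝ≥0∞} : Fact (1 ≤ p.conjExponent) := ⟨le_self_add⟩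

lemma BV.memLp_conjExponent [Fact (1 ≤ (d : ℝ≥0∞))] (u : BV d) :
    MemLp u (ENNReal.conjExponent d) (volume.restrict (cube d)) := by
  obtain ⟨C, hC⟩ := BV.exists_eLpNorm_le_variation (Nat.one_le_cast.1 (Fact.out : 1 ≤ (d : ℝ≥0∞)))
  exact ⟨u.integrable.1.restrict,
    (hC u).trans_lt (ENNReal.mul_lt_top ENNReal.coe_lt_top u.variation_lt_top)⟩

/-- The Sobolev embedding of `BV([0,1]^d)` in `L^p([0,1]^d)`, where `1/d + 1/p = 1`. -/
def BV.toLp (d : ℕ) [Fact (1 ≤ (d : ℝ≥0∞))] :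
    BV d →L[ℝ] Lp ℝ (ENNReal.conjExponent d) (volume.restrict (cube d)) :=
  LinearMap.mkContinuousOfExistsBound
    { toFun := fun u => u.memLp_conjExponent.toLp u
      map_add' := fun u w => by
        rw [← MemLp.toLp_add, MemLp.toLp_eq_toLp_iff]
        exact ae_restrict_of_ae (BV.coeFn_add u w)
      map_smul' := fun c u => by
        rw [RingHom.id_apply, ← MemLp.toLp_const_smul, MemLp.toLp_eq_toLp_iff]
        exact ae_restrict_of_ae (BV.coeFn_smul c u) } <| by
    obtain ⟨C, hC⟩ := BV.exists_eLpNorm_le_variation (Nat.one_le_cast.1 (Fact.out : 1 ≤ (d : ℝ≥0∞)))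
    refine ⟨C, fun u => ?_⟩
    calc ‖u.memLp_conjExponent.toLp u‖
        = (eLpNorm u (ENNReal.conjExponent d) (volume.restrict (cube d))).toReal :=
          Lp.norm_toLp _ _
      _ ≤ C * (variation u).toReal := by
          simpa using ENNReal.toReal_mono
            (ENNReal.mul_ne_top ENNReal.coe_ne_top u.variation_lt_top.ne) (hC u)
      _ ≤ C * ‖u‖ := by gcongr; exact u.toReal_variation_le_norm

lemma BV.coeFn_toLp [Fact (1 ≤ (d : ℝ≥0∞))] (u : BV d) :
    BV.toLp d u =ᵐ[volume.restrict (cube d)] u :=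
  u.memLp_conjExponent.coeFn_toLp

/-- The operator `T : L^d([0,1]^d) → BV([0,1]^d)^*`, `f ↦ T_f`. -/
def chargeOperator (d : ℕ) [Fact (1 ≤ (d : ℝ≥0∞))] :
    Lp ℝ d (volume.restrict (cube d)) →L[ℝ] StrongDual ℝ (BV d) :=
  (ContinuousLinearMap.precomp ℝ (BV.toLp d)).comp
    ((ContinuousLinearMap.mul ℝ ℝ).lpPairing (volume.restrict (cube d)) d (ENNReal.conjExponent d))

lemma represents_chargeOperator [Fact (1 ≤ (d : ℝ≥0∞))]
    (f : Lp ℝ d (volume.restrict (cube d))) : Represents f (chargeOperator d f) := fun u =>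
  ⟨(Lp.memLp f).integrable_mul u.memLp_conjExponent,
    (lpPairing_eq_integral _ _ _).trans <|
      integral_congr_ae (u.coeFn_toLp.mono fun x hx => congrArg (f x * ·) hx)⟩

lemma chargeOperator_mem_rangeT [Fact (1 ≤ (d : ℝ≥0∞))]
    (f : Lp ℝ d (volume.restrict (cube d))) : chargeOperator d f ∈ rangeT d :=
  ⟨f, Lp.memLp f, represents_chargeOperator f⟩

lemma Represents.congr_ae {f g : Euc d → ℝ} {α : StrongDual ℝ (BV d)} (hα : Represents f α)
    (hfg : f =ᵐ[volume.restrict (cube d)] g) : Represents g α := fun u => by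
  have h : (fun x => f x * u x) =ᵐ[volume.restrict (cube d)] fun x => g x * u x :=
    hfg.mono fun x hx => congrArg (· * u x) hx
  exact ⟨(hα u).1.congr h, (hα u).2.trans (integral_congr_ae h)⟩

lemma Represents.unique {f : Euc d → ℝ} {α β : StrongDual ℝ (BV d)} (hα : Represents f α)
    (hβ : Represents f β) : α = β :=
  ContinuousLinearMap.ext fun u => (hα u).2.trans (hβ u).2.symm

lemma range_chargeOperator [Fact (1 ≤ (d : ℝ≥0∞))] :
    (chargeOperator d).range = rangeT d := by
  refine le_antisymm ?_ ?_
  · rintro _ ⟨f, rfl⟩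
    exact chargeOperator_mem_rangeT f
  · rintro α ⟨f, hf, hα⟩
    exact ⟨hf.toLp f, (represents_chargeOperator _).unique (hα.congr_ae hf.coeFn_toLp.symm)⟩

end BoundedVariation

section WeakCompactness

variable {X ι : Type*} [TopologicalSpace X] [T2Space X] [MeasurableSpace X] [BorelSpace X]
  {μ : Measure X} {K : Set X} {h : ι → X → ℝ} {M : ℝ}

lemma exists_finiteMeasure_tendsto_integral_mul_of_nonneg (hK : IsCompact K) (U : Ultrafilter ι)
    (hi : ∀ i, Integrable (h i) μ) (hpos : ∀ i x, 0 ≤ h i x) (h0 : ∀ i, ∀ x ∉ K, h i x = 0)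
    (hM : ∀ i, ∫ x, h i x ∂μ ≤ M) :
    ∃ ρ : FiniteMeasure X, ∀ g : BoundedContinuousFunction X ℝ,
      Tendsto (fun i => ∫ x, h i x * g x ∂μ) U (𝓝 (∫ x, g x ∂ρ)) := by
  let ρ (i : ι) : FiniteMeasure X :=
    ⟨μ.withDensity fun x => ENNReal.ofReal (h i x), isFiniteMeasure_withDensity_ofReal (hi i).2⟩
  have hmass (i) : (ρ i).mass ≤ M.toNNReal := by
    rw [← ENNReal.coe_le_coe, FiniteMeasure.ennreal_mass]
    change μ.withDensity _ univ ≤ ENNReal.ofReal M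
    rw [withDensity_apply _ .univ, setLIntegral_univ,
      ← ofReal_integral_eq_lintegral_ofReal (hi i) (.of_forall (hpos i))]
    exact ENNReal.ofReal_le_ofReal (hM i)
  have hcompl (i) : ρ i Kᶜ = 0 := by
    rw [FiniteMeasure.null_iff_toMeasure_null]
    change μ.withDensity _ Kᶜ = 0
    rw [withDensity_apply _ hK.measurableSet.compl]
    exact setLIntegral_eq_zero hK.measurableSet.compl fun x hx => by simp [h0 i x hx]
  obtain ⟨ρ', -, hρ'⟩ :=
    (isCompact_setOfPred_finiteMeasure_le_of_isCompact M.toNNReal hK).ultrafilter_le_nhds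
      (U.map ρ) (le_principal_iff.2 (Ultrafilter.mem_map.2
        (univ_mem' fun i => ⟨hmass i, hcompl i⟩)))
  refine ⟨ρ', fun g => ?_⟩
  have hlim := FiniteMeasure.tendsto_iff_forall_integral_tendsto.1 hρ' g
  refine (tendsto_map'_iff.1 hlim).congr fun i => ?_
  change ∫ x, g x ∂(μ.withDensity fun x => ENNReal.ofReal (h i x)) = _
  rw [integral_withDensity_eq_integral_toReal_smul₀ (hi i).1.aemeasurable.ennreal_ofReal
    (.of_forall fun x => ENNReal.ofReal_lt_top)]
  simp only [ENNReal.toReal_ofReal (hpos i _), smul_eq_mul]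

lemma exists_finiteMeasure_tendsto_integral_mul (hK : IsCompact K) (U : Ultrafilter ι)
    (hi : ∀ i, Integrable (h i) μ) (h0 : ∀ i, ∀ x ∉ K, h i x = 0)
    (hM : ∀ i, ∫ x, |h i x| ∂μ ≤ M) :
    ∃ P Q : FiniteMeasure X, ∀ g : BoundedContinuousFunction X ℝ,
      Tendsto (fun i => ∫ x, h i x * g x ∂μ) U (𝓝 (∫ x, g x ∂P - ∫ x, g x ∂Q)) := by
  obtain ⟨P, hP⟩ := exists_finiteMeasure_tendsto_integral_mul_of_nonneg hK U
    (fun i => (hi i).pos_part) (fun _ _ => le_max_right _ _) (fun i x hx => by simp [h0 i x hx])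
    (fun i => (integral_mono (hi i).pos_part (hi i).abs fun x =>
      max_le (le_abs_self _) (abs_nonneg _)).trans (hM i))
  obtain ⟨Q, hQ⟩ := exists_finiteMeasure_tendsto_integral_mul_of_nonneg hK U
    (fun i => (hi i).neg_part) (fun _ _ => le_max_right _ _) (fun i x hx => by simp [h0 i x hx])
    (fun i => (integral_mono (hi i).neg_part (hi i).abs fun x =>
      max_le (neg_le_abs _) (abs_nonneg _)).trans (hM i))
  refine ⟨P, Q, fun g => ((hP g).sub (hQ g)).congr fun i => ?_⟩
  have hg (f : X → ℝ) (hf : Integrable f μ) : Integrable (fun x => f x * g x) μ :=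
    hf.mul_bdd g.continuous.aestronglyMeasurable (.of_forall g.norm_coe_le_norm)
  rw [← integral_sub (hg _ (hi i).pos_part) (hg _ (hi i).neg_part)]
  simp only [← sub_mul, max_zero_sub_max_neg_zero_eq_self]

end WeakCompactness

section VectorMeasure

variable {X : Type*} {mX : MeasurableSpace X}

instance isFiniteMeasure_variation {E : Type*} [NormedAddCommGroup E] [NormedSpace ℝ E]
    [FiniteDimensional ℝ E] (μ : VectorMeasure X E) : IsFiniteMeasure μ.variation := by
  let b := Module.finBasis ℝ E
  let σ (i) : SignedMeasure X :=
    μ.mapRange (b.coord i).toAddMonoidHom (b.coord i).continuous_of_finiteDimensional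
  have hle : μ.variation ≤ ∑ i, ‖b i‖₊ • (σ i).variation := by
    refine VectorMeasure.variation_le_of_forall_enorm_le fun s _ => ?_
    calc ‖μ s‖ₑ = ‖∑ i, σ i s • b i‖ₑ := congrArg _ (b.sum_repr (μ s)).symm
      _ ≤ ∑ i, ‖σ i s • b i‖ₑ := enorm_sum_le _ _
      _ ≤ ∑ i, ‖b i‖₊ * (σ i).variation s := Finset.sum_le_sum fun i _ => by
          rw [enorm_smul, mul_comm]
          exact mul_le_mul_right (VectorMeasure.enorm_measure_le_variation _ _) _
      _ = (∑ i, ‖b i‖₊ • (σ i).variation) s := by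
          simp only [Measure.finsetSum_apply, Measure.smul_apply, ENNReal.smul_def, smul_eq_mul]
  have hfin (i) : IsFiniteMeasure (σ i).variation := by
    rw [← SignedMeasure.totalVariation_eq_variation]
    infer_instance
  exact isFiniteMeasure_of_le _ hle

/-- The vector measure `s ↦ σ(s) e` attached to a signed measure `σ` and a vector `e`. -/
def smulVector {E : Type*} [NormedAddCommGroup E] [NormedSpace ℝ E] (σ : SignedMeasure X)
    (e : E) : VectorMeasure X E :=
  σ.mapRange ((1 : ℝ →L[ℝ] ℝ).smulRight e).toLinearMap.toAddMonoidHom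
    ((1 : ℝ →L[ℝ] ℝ).smulRight e).continuous

lemma integral_smulVector_toSignedMeasure {E : Type*} [NormedAddCommGroup E]
    [InnerProductSpace ℝ E] [FiniteDimensional ℝ E] (ρ : Measure X) [IsFiniteMeasure ρ] (e : E)
    {f : X → E} (hf : ∀ ν : Measure X, IsFiniteMeasure ν → Integrable f ν) :
    (smulVector ρ.toSignedMeasure e).integral f (innerSL ℝ) = ∫ x, ⟪e, f x⟫_ℝ ∂ρ := by
  have hσ : ρ.toSignedMeasure.Integrable f := hf _ inferInstance
  let B : E →L[ℝ] ℝ →L[ℝ] ℝ := (lsmul ℝ ℝ).flip ∘L innerSL ℝ e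
  have hT : (smulVector ρ.toSignedMeasure e).transpose (innerSL ℝ)
      = ρ.toSignedMeasure.transpose B := by
    ext s _ x
    change ⟪x, ρ.toSignedMeasure s • e⟫_ℝ = ρ.toSignedMeasure s • ⟪e, x⟫_ℝ
    rw [inner_smul_right, real_inner_comm, smul_eq_mul]
  calc (smulVector ρ.toSignedMeasure e).integral f (innerSL ℝ)
      = ρ.toSignedMeasure.integral f B := by
        rw [VectorMeasure.integral_eq_setToFun_transpose (hf _ inferInstance),
          VectorMeasure.integral_eq_setToFun_transpose hσ]
        simp only [hT]
    _ = ∫ x, ⟪e, f x⟫_ℝ ∂ρ := by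
        rw [← VectorMeasure.integral_toSignedMeasure]
        exact (VectorMeasure.integral_continuousLinearMap_comp hσ).symm

end VectorMeasure

section GradientMeasure

variable {d : ℕ}

lemma IsTestField.exists_boundedContinuousFunction_apply {v : Euc d → Euc d} (hv : IsTestField v)
    (i : Fin d) : ∃ g : BoundedContinuousFunction (Euc d) ℝ, ∀ x, g x = v x i := by
  obtain ⟨C, hC⟩ := hv.2.exists_bound_of_continuous hv.1.continuous
  exact ⟨.ofNormedAddCommGroup (fun x => v x i)
    ((EuclideanSpace.proj (𝕜 := ℝ) i).continuous.comp hv.1.continuous) C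
    fun x => (PiLp.norm_apply_le _ i).trans (hC x), fun x => rfl⟩

lemma exists_tendsto_integral_fderiv_mollify_mul {f : Euc d → ℝ} (hf : Integrable f)
    (hfc : HasCompactSupport f) (hV : variation f ≠ ⊤) (e : Euc d) (U : Ultrafilter ℕ) :
    ∃ P Q : FiniteMeasure (Euc d), ∀ g : BoundedContinuousFunction (Euc d) ℝ,
      Tendsto (fun n => ∫ x, fderiv ℝ (mollify volume (shrinkingBump (Euc d) n) f) x e * g x) U
        (𝓝 (∫ x, g x ∂P - ∫ x, g x ∂Q)) := by
  set w : ℕ → Euc d → ℝ := fun n => mollify volume (shrinkingBump (Euc d) n) f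
  have hw (n) : ContDiff ℝ 2 (w n) := (contDiff_mollify _ hf).of_le (by norm_cast)
  have hwc (n) : HasCompactSupport (w n) := hasCompactSupport_mollify _ hfc
  have hwV (n) : variation (w n) ≤ variation f := variation_mollify_le _ hf
  have hcont (n) : Continuous (fderiv ℝ (w n)) := (hw n).continuous_fderiv two_ne_zero
  have hint (n) : Integrable (fderiv ℝ (w n)) :=
    (hcont n).integrable_of_hasCompactSupport ((hwc n).fderiv ℝ)
  have hinte (n) : Integrable fun x => fderiv ℝ (w n) x e := (hint n).apply_continuousLinearMap e
  refine exists_finiteMeasure_tendsto_integral_mul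
    (hfc.isCompact.add (isCompact_closedBall 0 2)) U hinte (fun n x hx => ?_)
    (M := (variation f).toReal * ‖e‖) fun n => ?_
  · have hx' : x ∉ tsupport (fderiv ℝ (w n)) := fun h =>
      hx (tsupport_mollify_shrinkingBump_subset hfc n (tsupport_fderiv_subset ℝ h))
    rw [image_eq_zero_of_notMem_tsupport hx', _root_.zero_apply]
  · calc ∫ x, |fderiv ℝ (w n) x e|
        ≤ ∫ x, ‖fderiv ℝ (w n) x‖ * ‖e‖ :=
          integral_mono (hinte n).abs ((hint n).norm.mul_const _) fun x =>
            (fderiv ℝ (w n) x).le_opNorm e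
      _ = (∫ x, ‖fderiv ℝ (w n) x‖) * ‖e‖ := integral_mul_const _ _
      _ ≤ (variation f).toReal * ‖e‖ := by
          gcongr
          exact (integral_norm_fderiv_le_variation (hw n) (hwc n)
            (ne_top_of_le_ne_top hV (hwV n))).trans (ENNReal.toReal_mono hV (hwV n))

lemma integral_sum_smulVector_sub (P Q : Fin d → FiniteMeasure (Euc d)) {v : Euc d → Euc d}
    (hv : ∀ ν : Measure (Euc d), IsFiniteMeasure ν → Integrable v ν) :
    (∑ i, (smulVector (P i : Measure (Euc d)).toSignedMeasure (EuclideanSpace.single i (1 : ℝ))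
      - smulVector (Q i : Measure (Euc d)).toSignedMeasure (EuclideanSpace.single i 1))).integral v
        (dotCLM d) = ∑ i, (∫ x, v x i ∂(P i) - ∫ x, v x i ∂(Q i)) := by
  rw [VectorMeasure.integral_finsetSum_vectorMeasure fun i _ => hv _ inferInstance]
  refine Finset.sum_congr rfl fun i _ => ?_
  rw [VectorMeasure.integral_sub_vectorMeasure (hv _ inferInstance) (hv _ inferInstance), dotCLM,
    integral_smulVector_toSignedMeasure _ _ hv, integral_smulVector_toSignedMeasure _ _ hv]
  simp only [EuclideanSpace.inner_single_left, map_one, one_mul]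

theorem exists_isGradient {f : Euc d → ℝ} (hf : Integrable f) (hfc : HasCompactSupport f)
    (hV : variation f ≠ ⊤) : ∃ μ, IsGradient f μ := by
  choose P Q hPQ using fun i : Fin d => exists_tendsto_integral_fderiv_mollify_mul hf hfc hV
    (EuclideanSpace.single i 1) (hyperfilter ℕ)
  refine ⟨∑ i, (smulVector (P i : Measure (Euc d)).toSignedMeasure (EuclideanSpace.single i 1)
    - smulVector (Q i : Measure (Euc d)).toSignedMeasure (EuclideanSpace.single i 1)),
    fun v hv => ?_⟩
  have hvint (ν : Measure (Euc d)) (_ : IsFiniteMeasure ν) : Integrable v ν :=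
    hv.1.continuous.integrable_of_hasCompactSupport hv.2
  rw [integral_sum_smulVector_sub P Q hvint]
  choose g hg using hv.exists_boundedContinuousFunction_apply
  obtain ⟨C, hC⟩ := hv.exists_bound_divergence
  refine tendsto_nhds_unique ((tendsto_integral_mollify_mul (tendsto_rOut_shrinkingBump _) hf
    hv.continuous_divergence hC).mono_left Nat.hyperfilter_le_atTop) ?_
  simp only [← hg]
  refine (tendsto_finsetSum _ fun i _ => hPQ i (g i)).neg.congr fun n => ?_
  set w := mollify volume (shrinkingBump (Euc d) n) f
  have hw : ContDiff ℝ 1 w := (contDiff_mollify _ hf).of_le (by norm_cast)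
  have hint (i) : Integrable fun x => fderiv ℝ w x (EuclideanSpace.single i 1) * g i x :=
    (((hw.continuous_fderiv one_ne_zero).integrable_of_hasCompactSupport
      ((hasCompactSupport_mollify _ hfc).fderiv ℝ)).apply_continuousLinearMap _).mul_bdd
        (g i).continuous.aestronglyMeasurable (.of_forall (g i).norm_coe_le_norm)
  rw [integral_mul_divergence hw hv, ← integral_finsetSum _ fun i _ => hint i]
  simp only [hg, ← clm_apply_eq_sum_single]

theorem BV.isGradient_grad (u : BV d) : IsGradient (u : Euc d → ℝ) u.grad := by
  have hex : ∃ μ, IsGradient (u : Euc d → ℝ) μ := by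
    obtain ⟨μ, hμ⟩ := exists_isGradient (u.integrable.indicator (measurableSet_cube d))
      (hasCompactSupport_indicator_cube u)
      ((variation_congr u.indicator_ae_eq).trans_lt u.variation_lt_top).ne
    refine ⟨μ, fun v hv => (integral_congr_ae ?_).trans (hμ v hv)⟩
    exact u.indicator_ae_eq.mono fun x hx => congrArg (· * divergence v x) hx.symm
  rw [BV.grad, dif_pos hex]
  exact hex.choose_spec

end GradientMeasure

section Cutoff

variable {d : ℕ} {K : Set (Euc d)}

lemma exists_cutoff (hK : IsCompact K) {δ : ℝ} (hδ : 0 < δ) :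
    ∃ χ : Euc d → ℝ, ContDiff ℝ 1 χ ∧ HasCompactSupport χ ∧ (∀ᶠ x in 𝓝ˢ K, χ x = 1) ∧
      (∀ x ∉ Metric.thickening δ K, χ x = 0) ∧ ∀ x, χ x ∈ Icc (0 : ℝ) 1 := by
  obtain ⟨χ, hχ1, hχ0, hχI⟩ := exists_contMDiffMap_one_nhds_of_subset_interior (n := 1)
    𝓘(ℝ, Euc d) hK.isClosed (t := Metric.thickening δ K)
    (by simpa only [Metric.isOpen_thickening.interior_eq] using Metric.self_subset_thickening hδ K)
  refine ⟨χ, contMDiff_iff_contDiff.1 χ.contMDiff, ?_, hχ1, hχ0, hχI⟩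
  exact .intro hK.cthickening fun x hx =>
    hχ0 x (mt (Metric.thickening_subset_cthickening δ K ·) hx)

lemma exists_seq_cutoff (hK : IsCompact K) :
    ∃ χ : ℕ → Euc d → ℝ, (∀ n, ContDiff ℝ 1 (χ n)) ∧ (∀ n, HasCompactSupport (χ n)) ∧
      (∀ n, ∀ᶠ x in 𝓝ˢ K, χ n x = 1) ∧ (∀ n x, χ n x ∈ Icc (0 : ℝ) 1) ∧
      ∀ x, Tendsto (fun n => χ n x) atTop (𝓝 (K.indicator 1 x)) := by
  choose χ hχ hχc hχ1 hχ0 hχI using fun n : ℕ =>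
    exists_cutoff hK (δ := 1 / ((n : ℝ) + 1)) (by positivity)
  refine ⟨χ, hχ, hχc, hχ1, hχI, fun x => tendsto_const_nhds.congr' ?_⟩
  by_cases hx : x ∈ K
  · exact .of_forall fun n => by simp [hx, (hχ1 n).self_of_nhdsSet x hx]
  · have hfar : ∀ᶠ δ in 𝓝 (0 : ℝ), x ∉ Metric.thickening δ K :=
      Metric.eventually_notMem_thickening_of_infEDist_pos (by rwa [hK.isClosed.closure_eq])
    filter_upwards [tendsto_one_div_add_atTop_nhds_zero_nat.eventually hfar] with n hn
    simp [hx, hχ0 n x hn]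

lemma norm_smul_le_of_mem_Icc {E : Type*} [SeminormedAddCommGroup E] [NormedSpace ℝ E] {a : ℝ}
    (ha : a ∈ Icc (0 : ℝ) 1) (x : E) : ‖a • x‖ ≤ ‖x‖ := by
  rw [norm_smul, Real.norm_of_nonneg ha.1]
  exact mul_le_of_le_one_left (norm_nonneg _) ha.2

lemma exists_isTestField_approx [CompactSpace K] (v : C(K, Euc d)) {ε : ℝ} (hε : 0 < ε) :
    ∃ w : Euc d → Euc d, IsTestField w ∧ (∀ x, ‖w x‖ ≤ ‖v‖ + ε) ∧
      ∀ x : K, ‖w x - v x‖ ≤ ε := by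
  have hK : IsCompact K := isCompact_iff_compactSpace.2 ‹_›
  obtain ⟨f, hf_norm, hf_eq⟩ :=
    (BoundedContinuousFunction.mkOfCompact v).exists_norm_eq_domRestrict_eq (𝕜 := ℝ) hK.isClosed
  obtain ⟨g, hg, hgf, -⟩ := f.continuous.exists_contDiff_approx 1 (ε := fun _ => ε)
    continuous_const fun _ => hε
  obtain ⟨χ, hχ, hχc, hχ1, -, hχI⟩ := exists_cutoff hK zero_lt_one
  refine ⟨fun x => χ x • g x, IsTestField.smul hχ hχc hg, fun x => ?_, fun x => ?_⟩
  · calc ‖χ x • g x‖ ≤ ‖g x‖ := norm_smul_le_of_mem_Icc (hχI x) _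
      _ ≤ ‖f x‖ + ‖g x - f x‖ := norm_le_insert' _ _
      _ ≤ ‖v‖ + ε := by
        refine add_le_add ((f.norm_coe_le_norm x).trans_eq hf_norm) ?_
        exact (dist_eq_norm (g x) (f x)).symm.trans_le (hgf x).le
  · have hfv : f x = v x := DFunLike.congr_fun hf_eq x
    simpa only [hχ1.self_of_nhdsSet x x.2, one_smul, ← hfv, ← dist_eq_norm] using (hgf x).le

end Cutoff

section Pairing

variable {d : ℕ} {K : Set (Euc d)}

lemma integral_mul_divergence_congr {u : Euc d → ℝ} (hu : ∀ᵐ x, x ∉ K → u x = 0)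
    {v w : Euc d → Euc d} (h : ∀ᶠ x in 𝓝ˢ K, v x = w x) :
    ∫ x, u x * divergence v x = ∫ x, u x * divergence w x := by
  refine integral_congr_ae ?_
  filter_upwards [hu] with x hux
  by_cases hx : x ∈ K
  · have hvw : v =ᶠ[𝓝 x] w := h.filter_mono (nhds_le_nhdsSet hx)
    simp only [divergence, hvw.fderiv_eq]
  · simp only [hux hx, zero_mul]

-- A cutoff equal to `1` near `K` leaves `∫ u div w` unchanged; shrinking its support to `K` shows
-- that `Du` does not charge the complement of `K`.
lemma IsGradient.integral_indicator {u : Euc d → ℝ} {μ : VectorMeasure (Euc d) (Euc d)}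
    (hμ : IsGradient u μ) (hK : IsCompact K) (hu : ∀ᵐ x, x ∉ K → u x = 0)
    {w : Euc d → Euc d} (hw : IsTestField w) :
    μ.integral (K.indicator w) (dotCLM d) = -∫ x, u x * divergence w x := by
  obtain ⟨χ, hχ, hχc, hχ1, hχI, hχlim⟩ := exists_seq_cutoff hK
  obtain ⟨C, hC⟩ := hw.2.exists_bound_of_continuous hw.1.continuous
  have hlim : Tendsto (fun n => μ.integral (fun x => χ n x • w x) (dotCLM d)) atTop
      (𝓝 (μ.integral (K.indicator w) (dotCLM d))) := by
    refine VectorMeasure.tendsto_integral_filter_of_norm_le_const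
      (.of_forall fun n => ((hχ n).continuous.smul hw.1.continuous).aestronglyMeasurable)
      ⟨C, .of_forall fun n => .of_forall fun x => ?_⟩ (.of_forall fun x => ?_)
    · exact (norm_smul_le_of_mem_Icc (hχI n x) _).trans (hC x)
    · have hχw := (hχlim x).smul_const (w x)
      by_cases hx : x ∈ K <;> simpa [hx] using hχw
  refine tendsto_nhds_unique hlim (tendsto_const_nhds.congr fun n => ?_)
  have hχw : ∀ᶠ x in 𝓝ˢ K, w x = χ n x • w x := by
    filter_upwards [hχ1 n] with x hx
    rw [hx, one_smul]
  rw [integral_mul_divergence_congr hu hχw, hμ _ (.smul (hχ n) (hχc n) hw.1), neg_neg]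

instance : CompactSpace (cube d) := isCompact_iff_compactSpace.1 (isCompact_cube d)

lemma norm_extend_le (v : C(cube d, Euc d)) (x : Euc d) :
    ‖Function.extend Subtype.val v 0 x‖ ≤ ‖v‖ := by
  by_cases hx : ∃ y : cube d, (y : Euc d) = x
  · obtain ⟨y, rfl⟩ := hx
    rw [Subtype.val_injective.extend_apply]
    exact v.norm_coe_le_norm y
  · simp [Function.extend_apply' _ _ _ hx]

lemma integrable_extend (v : C(cube d, Euc d)) (μ : VectorMeasure (Euc d) (Euc d)) :
    μ.Integrable (Function.extend Subtype.val v 0) := by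
  have hmeas : Measurable (Function.extend Subtype.val v 0) :=
    (MeasurableEmbedding.subtype_coe (measurableSet_cube d)).measurable_extend
      v.continuous.measurable measurable_zero
  exact Integrable.of_bound hmeas.aestronglyMeasurable ‖v‖ (.of_forall (norm_extend_le v))

lemma tendsto_integral_mul_divergence {v : C(cube d, Euc d)} {w : ℕ → Euc d → Euc d}
    (hw : ∀ n, IsTestField (w n)) {C : ℝ} (hC : ∀ n x, ‖w n x‖ ≤ C)
    (hlim : ∀ x : cube d, Tendsto (fun n => w n x) atTop (𝓝 (v x))) (u : BV d) :
    Tendsto (fun n => ∫ x, u x * divergence (w n) x) atTop (𝓝 (fracDiv v u)) := by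
  have hgrad := fun n =>
    (BV.isGradient_grad u).integral_indicator (isCompact_cube d) u.2.1 (hw n)
  rw [fracDiv, ← VectorMeasure.integral_indicator (measurableSet_cube d)]
  simp_rw [← neg_eq_iff_eq_neg.2 (hgrad _)]
  refine (VectorMeasure.tendsto_integral_filter_of_norm_le_const (.of_forall fun n => ?_)
    ⟨C, .of_forall fun n => .of_forall fun x => ?_⟩ (.of_forall fun x => ?_)).neg
  · exact ((hw n).1.continuous.aestronglyMeasurable).indicator (measurableSet_cube d)
  · exact (norm_indicator_le_norm_self _ _).trans (hC n x)
  · by_cases hx : x ∈ cube d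
    · have hval : Function.extend Subtype.val v 0 x = v ⟨x, hx⟩ :=
        Subtype.val_injective.extend_apply v 0 ⟨x, hx⟩
      simpa only [indicator_of_mem hx, hval] using hlim ⟨x, hx⟩
    · simp only [indicator_of_notMem hx, tendsto_const_nhds]

/-- The restriction of a test field to the cube, as an element of the domain of the divergence
operator. -/
def IsTestField.restrictCube {w : Euc d → Euc d} (hw : IsTestField w) : C(cube d, Euc d) :=
  ⟨fun x => w x, hw.1.continuous.comp continuous_subtype_val⟩

lemma fracDiv_restrictCube {w : Euc d → Euc d} (hw : IsTestField w) (u : BV d) :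
    fracDiv hw.restrictCube u = ∫ x, u x * divergence w x := by
  obtain ⟨C, hC⟩ := hw.2.exists_bound_of_continuous hw.1.continuous
  exact tendsto_nhds_unique (tendsto_integral_mul_divergence (fun _ : ℕ => hw) (fun _ => hC)
    (fun _ => tendsto_const_nhds) u) tendsto_const_nhds

lemma exists_seq_isTestField (v : C(cube d, Euc d)) :
    ∃ w : ℕ → Euc d → Euc d, ∃ hw : ∀ n, IsTestField (w n),
      (∀ (n : ℕ) x, ‖w n x‖ ≤ ‖v‖ + 1 / ((n : ℝ) + 1)) ∧
      Tendsto (fun n => (hw n).restrictCube) atTop (𝓝 v) ∧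
      ∀ u : BV d, Tendsto (fun n => ∫ x, u x * divergence (w n) x) atTop (𝓝 (fracDiv v u)) := by
  choose w hw hbound happrox using fun n : ℕ =>
    exists_isTestField_approx v (ε := 1 / ((n : ℝ) + 1)) (by positivity)
  have hlim : Tendsto (fun n => (hw n).restrictCube) atTop (𝓝 v) := by
    rw [tendsto_iff_norm_sub_tendsto_zero]
    exact squeeze_zero (fun _ => norm_nonneg _)
      (fun n => (ContinuousMap.norm_le _ (by positivity)).2 (happrox n))
      tendsto_one_div_add_atTop_nhds_zero_nat
  have hbound_one (n : ℕ) (x : Euc d) : ‖w n x‖ ≤ ‖v‖ + 1 :=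
    (hbound n x).trans (add_le_add_right (div_le_one_of_le₀ (by simp) (by positivity)) _)
  exact ⟨w, hw, hbound, hlim, tendsto_integral_mul_divergence hw hbound_one fun x =>
    ((continuous_eval_const x).tendsto v).comp hlim⟩

lemma fracDiv_add_left (v w : C(cube d, Euc d)) (u : BV d) :
    fracDiv (v + w) u = fracDiv v u + fracDiv w u := by
  have hext : Function.extend Subtype.val (v + w) 0
      = Function.extend Subtype.val v 0 + Function.extend Subtype.val w 0 := by
    rw [ContinuousMap.coe_add, ← Function.extend_add, add_zero]
  simp only [fracDiv, hext, VectorMeasure.integral_add (integrable_extend v _)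
    (integrable_extend w _), neg_add]

lemma fracDiv_smul_left (c : ℝ) (v : C(cube d, Euc d)) (u : BV d) :
    fracDiv (c • v) u = c • fracDiv v u := by
  have hext : Function.extend Subtype.val (c • v) 0 = c • Function.extend Subtype.val v 0 := by
    rw [ContinuousMap.coe_smul, ← Function.extend_smul, smul_zero]
  rw [fracDiv, hext, VectorMeasure.integral_smul, fracDiv, smul_neg]

lemma fracDiv_add_right (v : C(cube d, Euc d)) (u u' : BV d) :
    fracDiv v (u + u') = fracDiv v u + fracDiv v u' := by
  obtain ⟨w, hw, -, -, hlim⟩ := exists_seq_isTestField v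
  refine tendsto_nhds_unique (hlim (u + u')) (((hlim u).add (hlim u')).congr fun n => ?_)
  rw [← integral_add ((hw n).integrable_mul u.integrable) ((hw n).integrable_mul u'.integrable)]
  refine integral_congr_ae ((BV.coeFn_add u u').mono fun x hx => ?_)
  simp only [hx, Pi.add_apply, add_mul]

lemma fracDiv_smul_right (c : ℝ) (v : C(cube d, Euc d)) (u : BV d) :
    fracDiv v (c • u) = c • fracDiv v u := by
  obtain ⟨w, -, -, -, hlim⟩ := exists_seq_isTestField v
  refine tendsto_nhds_unique (hlim (c • u)) (((hlim u).const_smul c).congr fun n => ?_)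
  rw [← integral_smul]
  refine integral_congr_ae ((BV.coeFn_smul c u).mono fun x hx => ?_)
  simp only [hx, Pi.smul_apply, smul_eq_mul, mul_assoc]

lemma abs_fracDiv_le (v : C(cube d, Euc d)) (u : BV d) :
    |fracDiv v u| ≤ ‖v‖ * (variation u).toReal := by
  obtain ⟨w, hw, hbound, -, hlim⟩ := exists_seq_isTestField v
  have hM : Tendsto (fun n : ℕ => (‖v‖ + 1 / ((n : ℝ) + 1)) * (variation u).toReal) atTop
      (𝓝 (‖v‖ * (variation u).toReal)) := by
    simpa using ((tendsto_one_div_add_atTop_nhds_zero_nat (𝕜 := ℝ)).const_add ‖v‖).mul_const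
      (variation u).toReal
  exact le_of_tendsto_of_tendsto' (hlim u).abs hM fun n =>
    abs_integral_mul_divergence_le u.variation_lt_top.ne (hw n) (by positivity) (hbound n)

end Pairing

section Operator

variable {d : ℕ}

/-- The divergence operator `v ↦ fracDiv v` with values in the normed dual of `BV([0,1]^d)`. -/
def fracDivOperator (d : ℕ) : C(cube d, Euc d) →L[ℝ] StrongDual ℝ (BV d) :=
  (LinearMap.mk₂ ℝ fracDiv fracDiv_add_left fracDiv_smul_left fracDiv_add_right
    fracDiv_smul_right).mkContinuous₂ 1 fun v u => by
      rw [one_mul]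
      exact (abs_fracDiv_le v u).trans
        (mul_le_mul_of_nonneg_left u.toReal_variation_le_norm (norm_nonneg v))

lemma represents_divergence {w : Euc d → Euc d} (hw : IsTestField w) :
    Represents (divergence w) (fracDivOperator d hw.restrictCube) := fun u => by
  refine ⟨?_, ?_⟩
  · simpa only [mul_comm] using (hw.integrable_mul u.integrable).integrableOn
  · refine (fracDiv_restrictCube hw u).trans ?_
    simp_rw [mul_comm]
    refine (setIntegral_eq_integral_of_ae_compl_eq_zero (u.2.1.mono fun x hx hxc => ?_)).symm
    have hux : u x = 0 := hx hxc
    rw [hux, mul_zero]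

lemma memLp_divergence {w : Euc d → Euc d} (hw : IsTestField w) (p : ℝ≥0∞) (μ : Measure (Euc d))
    [IsFiniteMeasureOnCompacts μ] : MemLp (divergence w) p μ :=
  hw.continuous_divergence.memLp_of_hasCompactSupport hw.hasCompactSupport_divergence

lemma fracDivOperator_mem_SCH (v : C(cube d, Euc d)) : fracDivOperator d v ∈ SCH d := by
  obtain ⟨w, hw, -, hlim, -⟩ := exists_seq_isTestField v
  refine mem_closure_of_tendsto (((fracDivOperator d).continuous.tendsto v).comp hlim)
    (.of_forall fun n => ?_)
  exact ⟨divergence (w n), memLp_divergence (hw n) d _, represents_divergence (hw n)⟩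

/-- The divergence operator with values in the space of strong charge functionals. -/
def fracDivSCH (d : ℕ) : C(cube d, Euc d) →L[ℝ] SCH d :=
  (fracDivOperator d).codRestrict (SCH d) fracDivOperator_mem_SCH

end Operator

section LpFunctional

variable {X : Type*} {mX : MeasurableSpace X} {m : Measure X} [IsFiniteMeasure m] {p : ℝ≥0∞}

lemma indicatorConstLp_biUnion {E : Type*} [NormedAddCommGroup E] {A : ℕ → Set X}
    (hA : ∀ i, MeasurableSet (A i)) (hdisj : Pairwise (Function.onFun Disjoint A)) (c : E)
    (s : Finset ℕ) :
    indicatorConstLp p (s.measurableSet_biUnion fun i _ => hA i) (measure_ne_top m _) c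
      = ∑ i ∈ s, indicatorConstLp p (hA i) (measure_ne_top m (A i)) c := by
  induction s using Finset.induction_on with
  | empty => simp
  | insert a s ha ih =>
    have hdisj_a : Disjoint (A a) (⋃ i ∈ s, A i) :=
      disjoint_iUnion₂_right.2 fun i hi => hdisj fun h => ha (h ▸ hi)
    rw [Finset.sum_insert ha, ← ih, ← indicatorConstLp_disjoint_union _ _ _ _ hdisj_a]
    simp only [Finset.set_biUnion_insert]

lemma hasSum_indicatorConstLp {E : Type*} [NormedAddCommGroup E] [Fact (1 ≤ p)] (hp : p ≠ ⊤)
    {A : ℕ → Set X} (hA : ∀ i, MeasurableSet (A i))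
    (hdisj : Pairwise (Function.onFun Disjoint A)) (c : E) :
    HasSum (fun i => indicatorConstLp p (hA i) (measure_ne_top m (A i)) c)
      (indicatorConstLp p (.iUnion hA) (measure_ne_top m (⋃ i, A i)) c) := by
  rw [HasSum, SummationFilter.unconditional_filter]
  simp_rw [← indicatorConstLp_biUnion hA hdisj]
  refine tendsto_indicatorConstLp_set hp ?_
  have hmono : Monotone fun s : Finset ℕ => ⋃ i ∈ s, A i := fun s t hst =>
    biUnion_subset_biUnion_left hst
  have hmeasure := tendsto_measure_iUnion_atTop (μ := m) hmono
  rw [← iUnion_eq_iUnion_finset A] at hmeasure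
  have hsub := ENNReal.Tendsto.sub (tendsto_const_nhds (x := m (⋃ i, A i))) hmeasure
    (.inl (measure_ne_top _ _))
  rw [tsub_self] at hsub
  refine hsub.congr fun s => ?_
  have hs : (⋃ i ∈ s, A i) ⊆ ⋃ i, A i := iUnion₂_subset fun i _ => subset_iUnion A i
  rw [Function.comp_apply, symmDiff_of_le hs, measure_sdiff hs
    (s.measurableSet_biUnion fun i _ => hA i).nullMeasurableSet (measure_ne_top _ _)]

open Classical in
/-- The `L^p`-valued vector measure `A ↦ 1_A`. Composing it with a functional on `L^p` gives the
signed measure whose density represents the functional. -/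
def indicatorMeasure (m : Measure X) [IsFiniteMeasure m] [Fact (1 ≤ p)] (hp : p ≠ ⊤) :
    VectorMeasure X (Lp ℝ p m) where
  measureOf' A := if hA : MeasurableSet A then indicatorConstLp p hA (measure_ne_top m A) 1 else 0
  empty' := by simp
  not_measurable' _ hA := dif_neg hA
  m_iUnion' A hA hdisj := by
    simpa only [dif_pos (hA _), dif_pos (MeasurableSet.iUnion hA)]
      using hasSum_indicatorConstLp hp hA hdisj 1

lemma indicatorMeasure_apply [Fact (1 ≤ p)] (hp : p ≠ ⊤) {A : Set X} (hA : MeasurableSet A) :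
    indicatorMeasure m hp A = indicatorConstLp p hA (measure_ne_top m A) 1 := dif_pos hA

lemma exists_integrable_forall_indicatorConstLp [Fact (1 ≤ p)] (hp : p ≠ ⊤)
    (l : StrongDual ℝ (Lp ℝ p m)) :
    ∃ g : X → ℝ, Integrable g m ∧ ∀ (A : Set X) (hA : MeasurableSet A),
      l (indicatorConstLp p hA (measure_ne_top m A) 1) = ∫ x in A, g x ∂m := by
  let ν : SignedMeasure X := (indicatorMeasure m hp).mapRange (l : Lp ℝ p m →+ ℝ) l.continuous
  have hν {A : Set X} (hA : MeasurableSet A) :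
      ν A = l (indicatorConstLp p hA (measure_ne_top m A) 1) :=
    congrArg l (indicatorMeasure_apply hp hA)
  have hac : ν ≪ᵥ m.toENNRealVectorMeasure := by
    refine VectorMeasure.AbsolutelyContinuous.mk fun A hA hmA => ?_
    rw [Measure.toENNRealVectorMeasure_apply_measurable hA] at hmA
    have hzero : indicatorConstLp p hA (measure_ne_top m A) (1 : ℝ) = 0 := by
      rw [Lp.eq_zero_iff_ae_eq_zero]
      exact indicatorConstLp_coeFn.trans (indicator_meas_zero hmA)
    rw [hν hA, hzero, map_zero]
  refine ⟨ν.rnDeriv m, SignedMeasure.integrable_rnDeriv _ _, fun A hA => ?_⟩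
  rw [← withDensityᵥ_apply (SignedMeasure.integrable_rnDeriv _ _) hA,
    SignedMeasure.withDensityᵥ_rnDeriv_eq _ _ hac, hν hA]

lemma indicatorConstLp_eq_smul {A : Set X} (hA : MeasurableSet A) (c : ℝ) :
    indicatorConstLp p hA (measure_ne_top m A) c
      = c • indicatorConstLp p hA (measure_ne_top m A) (1 : ℝ) := by
  rw [indicatorConstLp, indicatorConstLp, ← MemLp.toLp_const_smul]
  refine MemLp.toLp_congr _ _ (.of_forall fun x => ?_)
  by_cases hx : x ∈ A <;> simp [hx]

lemma clm_ext_indicatorConstLp {F : Type*} [AddCommMonoid F] [TopologicalSpace F] [Module ℝ F]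
    [T2Space F] [Fact (1 ≤ p)] (hp : p ≠ ⊤) {l l' : Lp ℝ p m →L[ℝ] F}
    (h : ∀ (A : Set X) (hA : MeasurableSet A),
      l (indicatorConstLp p hA (measure_ne_top m A) 1)
        = l' (indicatorConstLp p hA (measure_ne_top m A) 1)) : l = l' := by
  ext f
  induction f using Lp.induction hp with
  | indicatorConst c hA hmA =>
    rw [Lp.simpleFunc.coe_indicatorConst, indicatorConstLp_eq_smul, map_smul, map_smul, h]
  | add hf hg _ ihf ihg => rw [map_add, map_add, ihf, ihg]
  | isClosed => exact isClosed_eq l.continuous l'.continuous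

lemma apply_toLp_simpleFunc [Fact (1 ≤ p)] {l : StrongDual ℝ (Lp ℝ p m)} {g : X → ℝ}
    (hg : Integrable g m)
    (hl : ∀ (A : Set X) (hA : MeasurableSet A),
      l (indicatorConstLp p hA (measure_ne_top m A) 1) = ∫ x in A, g x ∂m)
    (f : SimpleFunc X ℝ) (hf : MemLp f p m) : l (hf.toLp f) = ∫ x, f x * g x ∂m := by
  induction f using SimpleFunc.induction with
  | @const c A hA =>
    have hind : hf.toLp _ = indicatorConstLp p hA (measure_ne_top m A) c := by
      refine MemLp.toLp_congr _ _ (.of_forall fun x => ?_)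
      by_cases hx : x ∈ A <;> simp [hx]
    rw [hind, indicatorConstLp_eq_smul, map_smul, hl A hA, smul_eq_mul, ← integral_const_mul,
      ← integral_indicator hA]
    congr with x
    by_cases hx : x ∈ A <;> simp [hx]
  | @add f f' _ ihf ihf' =>
    have hf_mem (f : SimpleFunc X ℝ) : MemLp f p m := f.memLp_of_isFiniteMeasure p m
    have hf_int (f : SimpleFunc X ℝ) : Integrable (fun x => f x * g x) m :=
      hg.bdd_mul f.aestronglyMeasurable (.of_forall f.exists_forall_norm_le.choose_spec)
    have hadd : hf.toLp _ = (hf_mem f).toLp f + (hf_mem f').toLp f' := MemLp.toLp_add _ _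
    rw [hadd, map_add, ihf, ihf', ← integral_add (hf_int f) (hf_int f')]
    simp only [SimpleFunc.coe_add, Pi.add_apply, add_mul]

lemma apply_toLp_of_bounded [Fact (1 ≤ p)] (hp : p ≠ ⊤) {l : StrongDual ℝ (Lp ℝ p m)}
    {g : X → ℝ} (hg : Integrable g m)
    (hl : ∀ (A : Set X) (hA : MeasurableSet A),
      l (indicatorConstLp p hA (measure_ne_top m A) 1) = ∫ x in A, g x ∂m)
    {f : X → ℝ} (hf : MemLp f p m) (hfm : Measurable f) {C : ℝ} (hC : ∀ x, ‖f x‖ ≤ C) :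
    l (hf.toLp f) = ∫ x, f x * g x ∂m := by
  refine tendsto_nhds_unique
    ((l.continuous.tendsto _).comp (SimpleFunc.tendsto_approxOn_range_Lp hp hfm hf)) ?_
  simp only [Function.comp_def, apply_toLp_simpleFunc hg hl]
  refine tendsto_integral_of_dominated_convergence (fun x => (C + C) * ‖g x‖)
    (fun n => (SimpleFunc.aestronglyMeasurable _).mul hg.aestronglyMeasurable)
    (hg.norm.const_mul _) (fun n => .of_forall fun x => ?_) (.of_forall fun x => ?_)
  · rw [norm_mul]
    gcongr
    exact (SimpleFunc.norm_approxOn_zero_le hfm _ x n).trans (add_le_add (hC x) (hC x))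
  · exact (SimpleFunc.tendsto_approxOn hfm _ (subset_closure (by simp))).mul_const _

end LpFunctional

section Surjectivity

variable {E F : Type*} [NormedAddCommGroup E] [NormedSpace ℝ E]
  [NormedAddCommGroup F] [NormedSpace ℝ F]

lemma surjective_of_exists_approx_preimage [CompleteSpace E] (f : E →L[ℝ] F) {C : ℝ}
    (hC : 0 ≤ C) (happrox : ∀ y, ∃ x, ‖y - f x‖ ≤ 1 / 2 * ‖y‖ ∧ ‖x‖ ≤ C * ‖y‖) :
    Function.Surjective f := by
  choose g hg_approx hg_norm using happrox
  intro y
  let residual : ℕ → F := fun n => (fun z => z - f (g z))^[n] y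
  have hres_succ (n : ℕ) : residual (n + 1) = residual n - f (g (residual n)) :=
    Function.iterate_succ_apply' _ n y
  have hres_norm (n : ℕ) : ‖residual n‖ ≤ (1 / 2) ^ n * ‖y‖ := by
    induction n with
    | zero => simp [residual]
    | succ n ih =>
      rw [hres_succ, pow_succ', mul_assoc]
      exact (hg_approx _).trans (by gcongr)
  have hsummable : Summable fun n => g (residual n) := by
    refine .of_norm_bounded (summable_geometric_two.mul_right (C * ‖y‖)) fun n => ?_
    calc ‖g (residual n)‖ ≤ C * ‖residual n‖ := hg_norm _
      _ ≤ C * ((1 / 2) ^ n * ‖y‖) := mul_le_mul_of_nonneg_left (hres_norm n) hC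
      _ = (1 / 2) ^ n * (C * ‖y‖) := by ring
  have hpartial (n : ℕ) : f (∑ i ∈ Finset.range n, g (residual i)) = y - residual n := by
    induction n with
    | zero => simp [residual]
    | succ n ih => rw [Finset.sum_range_succ, map_add, ih, hres_succ, sub_add]
  have hres_zero : Tendsto residual atTop (𝓝 0) := by
    refine squeeze_zero_norm hres_norm ?_
    simpa using (tendsto_pow_atTop_nhds_zero_of_lt_one (r := (1 / 2 : ℝ)) (by norm_num)
      (by norm_num)).mul_const ‖y‖
  have himage := (f.continuous.tendsto _).comp hsummable.hasSum.tendsto_sum_nat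
  simp only [Function.comp_def, hpartial] at himage
  exact ⟨_, tendsto_nhds_unique himage (by simpa using hres_zero.const_sub y)⟩

lemma mem_closure_image_closedBall (f : E →L[ℝ] F) {C : ℝ} (hC : 0 < C)
    (hdual : ∀ ξ : StrongDual ℝ F, ‖ξ‖ ≤ C * ‖ξ ∘L f‖) {y : F} (hy : y ≠ 0) :
    y ∈ closure (f '' Metric.closedBall 0 (C * ‖y‖)) := by
  by_contra hmem
  have hr : 0 < C * ‖y‖ := mul_pos hC (norm_pos_iff.2 hy)
  have hconvex : Convex ℝ (closure (f '' Metric.closedBall 0 (C * ‖y‖))) :=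
    ((convex_closedBall _ _).linear_image f.toLinearMap).closure
  obtain ⟨ξ, s, hball, hsy⟩ := geometric_hahn_banach_closed_point hconvex isClosed_closure hmem
  have hball' {x : E} (hx : ‖x‖ ≤ C * ‖y‖) : ξ (f x) ≤ s :=
    (hball _ (subset_closure ⟨x, mem_closedBall_zero_iff.2 hx, rfl⟩)).le
  have hnorm : ‖ξ ∘L f‖ ≤ s / (C * ‖y‖) := by
    refine opNorm_bound_of_ball_bound hr s _ fun x hx => abs_le'.2 ⟨?_, ?_⟩
    · exact hball' (mem_closedBall_zero_iff.1 hx)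
    · simpa using hball' (x := -x) (by simpa using hx)
  refine absurd hsy (not_lt.2 ?_)
  calc ξ y ≤ ‖ξ‖ * ‖y‖ := (le_abs_self _).trans (ξ.le_opNorm y)
    _ ≤ C * (s / (C * ‖y‖)) * ‖y‖ := by
      gcongr
      exact (hdual ξ).trans (by gcongr)
    _ = s := by field_simp

theorem surjective_of_forall_dual_norm_le [CompleteSpace E] (f : E →L[ℝ] F) {C : ℝ} (hC : 0 < C)
    (hdual : ∀ ξ : StrongDual ℝ F, ‖ξ‖ ≤ C * ‖ξ ∘L f‖) : Function.Surjective f := by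
  refine surjective_of_exists_approx_preimage f hC.le fun y => ?_
  rcases eq_or_ne y 0 with rfl | hy
  · exact ⟨0, by simp, by simp⟩
  obtain ⟨_, ⟨x, hx, rfl⟩, hxy⟩ := Metric.mem_closure_iff.1
    (mem_closure_image_closedBall f hC hdual hy) (1 / 2 * ‖y‖) (by positivity)
  exact ⟨x, (dist_eq_norm y (f x)).symm.trans_le hxy.le, mem_closedBall_zero_iff.1 hx⟩

end Surjectivity

section Duality

variable {d : ℕ}

lemma variation_le_norm_comp_fracDivSCH {ξ : StrongDual ℝ (SCH d)} {u : Euc d → ℝ}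
    (hξ : ∀ (w : Euc d → Euc d) (hw : IsTestField w),
      ξ (fracDivSCH d hw.restrictCube) = ∫ x, u x * divergence w x) :
    variation u ≤ ENNReal.ofReal ‖ξ ∘L fracDivSCH d‖ := by
  refine iSup_le fun w => iSup_le fun hw => iSup_le fun hw1 => ENNReal.ofReal_le_ofReal ?_
  have hnorm : ‖hw.restrictCube‖ ≤ 1 :=
    (ContinuousMap.norm_le _ zero_le_one).2 fun x => hw1 x
  calc ∫ x, u x * divergence w x = (ξ ∘L fracDivSCH d) hw.restrictCube := (hξ w hw).symm
    _ ≤ ‖ξ ∘L fracDivSCH d‖ := (le_abs_self _).trans <|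
      unit_le_opNorm (E := C(cube d, Euc d)) (ξ ∘L fracDivSCH d) _ hnorm

variable [Fact (1 ≤ (d : ℝ≥0∞))]

/-- The operator `f ↦ T_f` with values in the space of strong charge functionals. -/
def chargeSCH (d : ℕ) [Fact (1 ≤ (d : ℝ≥0∞))] :
    Lp ℝ d (volume.restrict (cube d)) →L[ℝ] SCH d :=
  (chargeOperator d).codRestrict (SCH d) fun f =>
    (rangeT d).le_topologicalClosure (chargeOperator_mem_rangeT f)

lemma chargeOperator_indicatorConstLp_apply {A : Set (Euc d)} (hA : MeasurableSet A) (u : BV d) :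
    chargeOperator d (indicatorConstLp d hA (measure_ne_top _ A) 1) u
      = ∫ x in A, u x ∂volume.restrict (cube d) := by
  let one_A : Lp ℝ d (volume.restrict (cube d)) := indicatorConstLp d hA (measure_ne_top _ A) 1
  have hone_A : one_A =ᵐ[volume.restrict (cube d)] A.indicator fun _ => 1 := indicatorConstLp_coeFn
  rw [← integral_indicator hA, (represents_chargeOperator _ u).2]
  refine integral_congr_ae (hone_A.mono fun x hx => ?_)
  dsimp only
  rw [hx, ← indicator_mul_left]
  simp only [one_mul]

lemma denseRange_chargeSCH : DenseRange (chargeSCH d) := by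
  refine Subtype.dense_iff.2 fun α hα => closure_mono ?_ hα
  rw [← range_chargeOperator]
  rintro _ ⟨f, rfl⟩
  exact ⟨chargeSCH d f, mem_range_self f, rfl⟩

lemma fracDivSCH_restrictCube {w : Euc d → Euc d} (hw : IsTestField w) :
    fracDivSCH d hw.restrictCube = chargeSCH d ((memLp_divergence hw d _).toLp (divergence w)) :=
  Subtype.ext <| (represents_divergence hw).unique <|
    (represents_chargeOperator _).congr_ae (memLp_divergence hw d _).coeFn_toLp

lemma apply_fracDivSCH_restrictCube {ξ : StrongDual ℝ (SCH d)} {g : Euc d → ℝ}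
    (hg : Integrable g (volume.restrict (cube d)))
    (hξ : ∀ (A : Set (Euc d)) (hA : MeasurableSet A),
      (ξ ∘L chargeSCH d) (indicatorConstLp d hA (measure_ne_top _ A) 1)
        = ∫ x in A, g x ∂volume.restrict (cube d))
    {w : Euc d → Euc d} (hw : IsTestField w) :
    ξ (fracDivSCH d hw.restrictCube) = ∫ x, (cube d).indicator g x * divergence w x := by
  obtain ⟨C, hC⟩ := hw.exists_bound_divergence
  rw [fracDivSCH_restrictCube]
  refine (apply_toLp_of_bounded (ENNReal.natCast_ne_top d) hg hξ (memLp_divergence hw d _)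
    hw.continuous_divergence.measurable hC).trans ?_
  simp_rw [← integral_indicator (measurableSet_cube d), indicator_mul_right _ (divergence w) g,
    mul_comm]

theorem exists_forall_dual_apply_eq (ξ : StrongDual ℝ (SCH d)) :
    ∃ u : BV d, variation u ≤ ENNReal.ofReal ‖ξ ∘L fracDivSCH d‖ ∧
      ∀ α : SCH d, ξ α = (α : StrongDual ℝ (BV d)) u := by
  obtain ⟨g, hg, hξg⟩ := exists_integrable_forall_indicatorConstLp (ENNReal.natCast_ne_top d)
    (ξ ∘L chargeSCH d)
  have hvar : variation ((cube d).indicator g) ≤ ENNReal.ofReal ‖ξ ∘L fracDivSCH d‖ :=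
    variation_le_norm_comp_fracDivSCH fun _ hw => apply_fracDivSCH_restrictCube hg hξg hw
  let u : BV d := BV.mk ((cube d).indicator g)
    ((integrable_indicator_iff (measurableSet_cube d)).2 hg)
    (fun _ hx => indicator_of_notMem hx g) (hvar.trans_lt ENNReal.ofReal_lt_top)
  have hu : u =ᵐ[volume] (cube d).indicator g := BV.coeFn_mk _ _ _
  refine ⟨u, (variation_congr hu).trans_le hvar, ?_⟩
  let eval_u : StrongDual ℝ (SCH d) := (apply ℝ ℝ u).comp (SCH d).subtypeL
  have heval : ξ ∘L chargeSCH d = eval_u ∘L chargeSCH d := by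
    refine clm_ext_indicatorConstLp (ENNReal.natCast_ne_top d) fun A hA => ?_
    have hug : u =ᵐ[volume.restrict (cube d)] g :=
      (EventuallyEq.restrict hu).trans (indicator_ae_eq_restrict (measurableSet_cube d))
    rw [hξg A hA, ← setIntegral_congr_ae hA (hug.mono fun x hx _ => hx)]
    exact (chargeOperator_indicatorConstLp_apply hA u).symm
  exact congrFun (denseRange_chargeSCH.equalizer ξ.continuous eval_u.continuous
    (funext (DFunLike.congr_fun heval)))

theorem surjective_fracDivSCH : Function.Surjective (fracDivSCH d) := by
  obtain ⟨C, hC⟩ := BV.exists_norm_le_variation (Nat.one_le_cast.1 (Fact.out : 1 ≤ (d : ℝ≥0∞)))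
  refine surjective_of_forall_dual_norm_le (E := C(cube d, Euc d)) (F := SCH d)
    (fracDivSCH d) (C := C + 1) (by positivity) fun ξ => ?_
  obtain ⟨u, hvar, hu⟩ := exists_forall_dual_apply_eq ξ
  have hnorm : ‖u‖ ≤ (C + 1) * ‖ξ ∘L fracDivSCH d‖ :=
    calc ‖u‖ ≤ C * (variation u).toReal := hC u
      _ ≤ C * ‖ξ ∘L fracDivSCH d‖ := by
        gcongr
        exact ENNReal.toReal_le_of_le_ofReal (opNorm_nonneg _) hvar
      _ ≤ (C + 1) * ‖ξ ∘L fracDivSCH d‖ := by gcongr; exact le_add_of_nonneg_right zero_le_one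
  refine ξ.opNorm_le_bound (by positivity) fun α => ?_
  calc ‖ξ α‖ = ‖(α : StrongDual ℝ (BV d)) u‖ := by rw [hu]
    _ ≤ ‖α‖ * ‖u‖ := le_opNorm _ _
    _ ≤ (C + 1) * ‖ξ ∘L fracDivSCH d‖ * ‖α‖ := by
      rw [mul_comm]
      gcongr

end Duality

end StrongCharge

end

theorem mainTheorem6 (d : ℕ) (hd : 1 ≤ d) :
    (∀ f : Euc d → ℝ, MemLp f d (volume.restrict (cube d)) →
      ∃ α : StrongDual ℝ (BV d), Represents f α) ∧
    (∀ u : BV d, IsGradient u u.grad) ∧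
    ∃ D : C(cube d, Euc d) →L[ℝ] SCH d,
      (∀ (v : C(cube d, Euc d)) (u : BV d),
        (D v : StrongDual ℝ (BV d)) u = fracDiv v u) ∧
      Function.Surjective D := by
  have : Fact (1 ≤ (d : ENNReal)) := ⟨by exact_mod_cast hd⟩
  exact ⟨fun f hf => ⟨chargeOperator d (hf.toLp f),
      (represents_chargeOperator _).congr_ae hf.coeFn_toLp⟩,
    BV.isGradient_grad, fracDivSCH d, fun _ _ => rfl, surjective_fracDivSCH⟩
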